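/- There are universal constants $\delta_0, C_0, K > 0$ and $k_0 \in \mathbb{N}$ such that the following holds for all real $\delta$ with $0 < \delta \le \delta_0$, all integers $k \ge k_0$ and all integers $$m \ge \max\Big(C_0 \log^3(1/\delta),\ \frac{k^2}{\log(1/\delta)}\Big).$$ We have $1/2 + \delta/\sqrt{m} \le 1$, and there is a probability distribution $A$ on $\{0, 1, \dots, m\}$ such that (i) $\mathbf{E}_{X \sim A}[X^i] = \mathbf{E}_{X \sim \mathrm{Bin}(m, 1/2)}[X^i]$ for all integers $1 \le i \le k$; (ii) $d_{\mathrm{TV}}\big(A, \mathrm{Bin}(m, 1/2 + \delta/\sqrt{m})\big) \le K\, \dfrac{\delta k^2}{\sqrt{\log(1/\delta)}}$; (iii) $\chi^2\big(A, \mathrm{Bin}(m, 1/2)\big) \le K \delta$. Here $\mathrm{Bin}(m, p)$ is the binomial distribution with $m$ trials and success probability $p$, $d_{\mathrm{TV}}(P, Q) = \sup_S |P(S) - Q(S)|$, and $\chi^2(P, Q) = \sum_x P(x)^2 / Q(x) - 1$. -/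

import Mathlib

open MeasureTheory ProbabilityTheory

/-- Total variation distance `sup_S |P(S) - Q(S)|`, the supremum running over the measurable
sets `S`. -/
noncomputable def tvDist {Ω : Type*} [MeasurableSpace Ω] (P Q : Measure Ω) : ℝ :=
  ⨆ S : {S : Set Ω // MeasurableSet S}, |P.real S.1 - Q.real S.1|

/-- The chi-squared divergence of distributions on `ℕ`, given by
`1 + χ²(P, Q) = ∑ₓ P(x)² / Q(x)`. It is `[0, ∞]`-valued: in `ℝ≥0∞`, a point outside both supports
contributes `0 / 0 = 0`, and a point with `Q(x) = 0 < P(x)` contributes `∞`. For probability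
measures the sum is at least `1`, so that the subtraction does not truncate. -/
noncomputable def chiSqDiv (P Q : Measure ℕ) : ENNReal :=
  (∑' x : ℕ, P {x} ^ 2 / Q {x}) - 1

/-- The binomial distribution with `m` trials and a real success probability `p ∈ [0, 1]`. -/
noncomputable def binDist (m : ℕ) (p : ℝ) (hp : p ∈ Set.Icc (0 : ℝ) 1) : Measure ℕ :=
  ProbabilityTheory.binomial m ⟨p, hp⟩

theorem half_mem_Icc : (1 / 2 : ℝ) ∈ Set.Icc (0 : ℝ) 1 := by
  constructor <;> norm_num

/-! Write the success probability as (1 + u)/2. The i-th moment of a binomial is a polynomial of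
degree at most i in u, so a signed mixture of binomials has the first k moments of the fair one as
soon as its mixing measure has the first k moments of the point mass at u = 0. With v₀ = δ/√m and L
= log(1/δ), A is the target binomial u = 2v₀ plus a signed correction ∑ cᵢ Bin(v₀ + tᵢ) of small
total mass. Recentred at v₀, the correction must match the moments of δ_{-v₀} - δ_{v₀}
(`sum_mul_shift_pow`). The nodes tᵢ are ±v₀ and ±lα for 1 ≤ l ≤ n, with nα of order √(L/m), and the
weights come from Lagrange interpolation at the squares l². These Lagrange weights are at most 2 in
absolute value, so ∑|cᵢ| = O(δk²/√L), which bounds the total variation distance.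

The difficulty is nonnegativity (`biasedBin_add_mixture_nonneg`). Relative to the fair binomial,
bias u has density (1+u)^x (1-u)^(m-x). For |2x - m| ≤ √(Lm) the main term is at least 1/2, while
the correction is at most O(δ) · δ^(-1/2). Beyond that the correction is nonnegative by itself: the
extreme node on that side has positive weight, and its density exceeds that of every other node by a
factor exp(L/(12n)). This beats the ratio of the weights because n³ is small compared with L.

For χ², biases u and v pair to (1 + uv)^m, so the correction contributes at most (∑|cᵢ|)² δ^(-1/2).
All this takes place when k⁴ < L; otherwise k²/√L ≥ 1 and the fair binomial itself serves as A. -/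

/-! ### Binomial masses: pairings and moments -/

/-- The mass at `x` of the binomial distribution with `m` trials and success probability
`(1 + u) / 2`. -/
noncomputable def biasedBin (m : ℕ) (u : ℝ) (x : ℕ) : ℝ :=
  m.choose x / 2 ^ m * ((1 + u) ^ x * (1 - u) ^ (m - x))

theorem biasedBin_eq {m x : ℕ} (hx : x ≤ m) (u : ℝ) :
    biasedBin m u x = m.choose x * ((1 + u) / 2) ^ x * (1 - (1 + u) / 2) ^ (m - x) := by
  have h : (1 - (1 + u) / 2) = (1 - u) / 2 := by ring
  have h2 : (2 : ℝ) ^ m = 2 ^ x * 2 ^ (m - x) := by rw [← pow_add]; congr 1; omega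
  rw [h, biasedBin, div_pow, div_pow, h2]
  field_simp

theorem biasedBin_nonneg {m x : ℕ} {u : ℝ} (hu : |u| ≤ 1) : 0 ≤ biasedBin m u x := by
  rw [abs_le] at hu
  have h1 : 0 ≤ 1 + u := by linarith
  have h2 : 0 ≤ 1 - u := by linarith
  unfold biasedBin
  positivity

theorem biasedBin_zero_pos {m x : ℕ} (hx : x ≤ m) : 0 < biasedBin m 0 x := by
  have := Nat.choose_pos hx
  simp only [biasedBin]
  positivity

theorem biasedBin_eq_mul_zero (m x : ℕ) (u : ℝ) :
    biasedBin m u x = biasedBin m 0 x * ((1 + u) ^ x * (1 - u) ^ (m - x)) := by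
  simp [biasedBin]

theorem sum_biasedBin (m : ℕ) (u : ℝ) : ∑ x ∈ Finset.range (m + 1), biasedBin m u x = 1 := by
  have h := add_pow (1 + u) (1 - u) m
  have h2 : (1 + u + (1 - u)) = 2 := by ring
  rw [h2] at h
  have : ∑ x ∈ Finset.range (m + 1), biasedBin m u x
      = (∑ x ∈ Finset.range (m + 1), (1 + u) ^ x * (1 - u) ^ (m - x) * m.choose x) / 2 ^ m := by
    rw [Finset.sum_div]
    refine Finset.sum_congr rfl fun x _ ↦ ?_
    simp only [biasedBin]; ring
  rw [this, ← h, div_self (by positivity)]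

/-- The quotient is again a product of an x-th and an (m-x)-th power, so the binomial theorem sums
it. All χ² computations rest on this identity. -/
theorem sum_biasedBin_mul_div (m : ℕ) (u v : ℝ) :
    ∑ x ∈ Finset.range (m + 1), biasedBin m u x * biasedBin m v x / biasedBin m 0 x
      = (1 + u * v) ^ m := by
  have h := add_pow ((1 + u) * (1 + v)) ((1 - u) * (1 - v)) m
  have h2 : ((1 + u) * (1 + v) + (1 - u) * (1 - v)) = 2 * (1 + u * v) := by ring
  rw [h2, mul_pow] at h
  have h3 : (1 + u * v) ^ m = (∑ x ∈ Finset.range (m + 1),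
      ((1 + u) * (1 + v)) ^ x * ((1 - u) * (1 - v)) ^ (m - x) * m.choose x) / 2 ^ m := by
    rw [← h]; field_simp
  rw [h3, Finset.sum_div]
  refine Finset.sum_congr rfl fun x hx ↦ ?_
  have hp := biasedBin_zero_pos (Nat.lt_succ_iff.mp (Finset.mem_range.mp hx))
  rw [biasedBin_eq_mul_zero m x u, biasedBin_eq_mul_zero m x v, div_eq_iff hp.ne']
  have : biasedBin m 0 x = m.choose x / 2 ^ m := by simp [biasedBin]
  rw [this]
  simp only [mul_pow]
  ring

/-- Absorbing one factor x by (x+1) C(m+1, x+1) = (m+1) C(m, x) lowers both m and the power, at the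
price of one factor 1 + u; this drives the induction on the degree of the moments. -/
theorem sum_pow_succ_mul_biasedBin (m i : ℕ) (u : ℝ) :
    ∑ x ∈ Finset.range (m + 2), (x : ℝ) ^ (i + 1) * biasedBin (m + 1) u x
      = (m + 1) / 2 * (1 + u) * ∑ j ∈ Finset.range (i + 1),
          i.choose j * ∑ x ∈ Finset.range (m + 1), (x : ℝ) ^ j * biasedBin m u x := by
  have h1 : ∀ x : ℕ, ((x + 1 : ℕ) : ℝ) ^ (i + 1) * biasedBin (m + 1) u (x + 1)
      = (m + 1) / 2 * (1 + u) * (((x : ℝ) + 1) ^ i * biasedBin m u x) := by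
    intro x
    have hc : ((m + 1).choose (x + 1) : ℝ) * (x + 1) = (m + 1) * m.choose x := by
      exact_mod_cast (Nat.add_one_mul_choose_eq m x).symm
    simp only [biasedBin, Nat.add_sub_add_right]
    push_cast
    rw [pow_succ ((x : ℝ) + 1) i, pow_succ (2 : ℝ) m, pow_succ (1 + u) x]
    field_simp
    linear_combination (1 + u) ^ x * (1 - u) ^ (m - x) * (1 + u) * hc
  rw [Finset.sum_range_succ']
  simp only [h1, Nat.cast_zero, ne_eq, Nat.succ_ne_zero, not_false_eq_true, zero_pow, zero_mul,
    add_zero]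
  rw [← Finset.mul_sum]
  congr 1
  simp only [Finset.mul_sum]
  rw [Finset.sum_comm]
  refine Finset.sum_congr rfl fun x _ ↦ ?_
  rw [add_pow, Finset.sum_mul]
  refine Finset.sum_congr rfl fun j _ ↦ ?_
  simp only [one_pow]
  ring

open Polynomial in
/-- The `i`-th moment of a binomial distribution is a polynomial of degree at most `i` in the
success probability. -/
theorem exists_polynomial_moment (i : ℕ) : ∀ m : ℕ, ∃ Q : ℝ[X], Q.natDegree ≤ i ∧
    ∀ u : ℝ, ∑ x ∈ Finset.range (m + 1), (x : ℝ) ^ i * biasedBin m u x = Q.eval u := by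
  induction i using Nat.strong_induction_on with
  | _ i ih =>
    rcases i with _ | i
    · intro m
      exact ⟨1, by simp, fun u ↦ by simp [sum_biasedBin]⟩
    · intro m
      rcases m with _ | m
      · exact ⟨0, by simp, fun u ↦ by simp⟩
      · have h : ∀ j, ∃ Q : ℝ[X], j < i + 1 → Q.natDegree ≤ j ∧ ∀ u : ℝ,
            ∑ x ∈ Finset.range (m + 1), (x : ℝ) ^ j * biasedBin m u x = Q.eval u := by
          intro j
          by_cases hj : j < i + 1
          · obtain ⟨Q, hQ⟩ := ih j hj m
            exact ⟨Q, fun _ ↦ hQ⟩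
          · exact ⟨0, fun h ↦ absurd h hj⟩
        choose Q hQ using h
        refine ⟨C (((m : ℝ) + 1) / 2) * (1 + X) *
          ∑ j ∈ Finset.range (i + 1), C (i.choose j : ℝ) * Q j, ?_, fun u ↦ ?_⟩
        · refine natDegree_mul_le.trans ?_
          have h1 : (C (((m : ℝ) + 1) / 2) * (1 + X)).natDegree ≤ 1 := by
            refine (natDegree_C_mul_le _ _).trans ?_
            rw [add_comm, ← C_1]
            exact (natDegree_X_add_C (1 : ℝ)).le
          have h2 : (∑ j ∈ Finset.range (i + 1), C (i.choose j : ℝ) * Q j).natDegree ≤ i := by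
            refine natDegree_sum_le_of_forall_le _ _ fun j hj ↦ ?_
            have hj' := Finset.mem_range.mp hj
            exact (natDegree_C_mul_le _ _).trans ((hQ j hj').1.trans (by omega))
          omega
        · rw [sum_pow_succ_mul_biasedBin]
          simp only [eval_mul, eval_C, eval_add, eval_one, eval_X, eval_finsetSum]
          congr 1
          refine Finset.sum_congr rfl fun j hj ↦ ?_
          rw [(hQ j (Finset.mem_range.mp hj)).2]

/-! ### Measures on {0, …, m} given by their masses -/

theorem binDist_singleton {m x : ℕ} {p u : ℝ} (hp : p ∈ Set.Icc (0 : ℝ) 1) (hu : p = (1 + u) / 2)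
    (hx : x ≤ m) : binDist m p hp {x} = ENNReal.ofReal (biasedBin m u x) := by
  rw [binDist, binomial_singleton, biasedBin_eq hx, ← hu]

theorem binDist_singleton_of_lt {m x : ℕ} {p : ℝ} (hp : p ∈ Set.Icc (0 : ℝ) 1) (hx : m < x) :
    binDist m p hp {x} = 0 := by
  rw [binDist, binomial_singleton, Nat.choose_eq_zero_of_lt hx]
  simp

instance isProbabilityMeasure_binDist {m : ℕ} {p : ℝ} {hp : p ∈ Set.Icc (0 : ℝ) 1} :
    IsProbabilityMeasure (binDist m p hp) := by
  unfold binDist; infer_instance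

/-- The measure on `{0, …, m}` with masses `a x`. -/
noncomputable def massMeasure (m : ℕ) (a : ℕ → ℝ) : Measure ℕ :=
  ∑ x ∈ Finset.range (m + 1), ENNReal.ofReal (a x) • Measure.dirac x

theorem massMeasure_singleton {m x : ℕ} (a : ℕ → ℝ) (hx : x ≤ m) :
    massMeasure m a {x} = ENNReal.ofReal (a x) := by
  rw [massMeasure, Measure.finsetSum_apply, Finset.sum_eq_single x]
  · simp
  · intro b _ hb; simp [hb]
  · intro h; simp at h; omega

theorem massMeasure_lt (m : ℕ) (a : ℕ → ℝ) : massMeasure m a {x : ℕ | m < x} = 0 := by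
  rw [massMeasure, Measure.finsetSum_apply]
  refine Finset.sum_eq_zero fun x hx ↦ ?_
  have : ¬ m < x := by simp at hx; omega
  simp [this]

theorem isProbabilityMeasure_massMeasure {m : ℕ} {a : ℕ → ℝ} (ha : ∀ x ≤ m, 0 ≤ a x)
    (hs : ∑ x ∈ Finset.range (m + 1), a x = 1) : IsProbabilityMeasure (massMeasure m a) := by
  constructor
  rw [massMeasure, Measure.finsetSum_apply]
  simp only [Measure.smul_apply, measure_univ, smul_eq_mul, mul_one]
  rw [← ENNReal.ofReal_sum_of_nonneg, hs, ENNReal.ofReal_one]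
  intro x hx
  exact ha x (Nat.lt_succ_iff.mp (Finset.mem_range.mp hx))

theorem integral_massMeasure {m : ℕ} {a : ℕ → ℝ} (ha : ∀ x ≤ m, 0 ≤ a x) (f : ℕ → ℝ) :
    ∫ x, f x ∂(massMeasure m a) = ∑ x ∈ Finset.range (m + 1), f x * a x := by
  rw [massMeasure, integral_finsetSum_measure]
  · refine Finset.sum_congr rfl fun x hx ↦ ?_
    rw [integral_smul_measure, integral_dirac, ENNReal.toReal_ofReal
      (ha x (Nat.lt_succ_iff.mp (Finset.mem_range.mp hx))), smul_eq_mul, mul_comm]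
  · exact fun _ _ ↦ (integrable_dirac (by simp)).smul_measure (by simp)

theorem massMeasure_biasedBin {m : ℕ} {p u : ℝ} (hp : p ∈ Set.Icc (0 : ℝ) 1)
    (hu : p = (1 + u) / 2) : massMeasure m (biasedBin m u) = binDist m p hp := by
  refine Measure.ext_of_singleton fun x ↦ ?_
  rcases le_or_gt x m with hx | hx
  · rw [massMeasure_singleton _ hx, binDist_singleton hp hu hx]
  · rw [binDist_singleton_of_lt hp hx]
    exact measure_mono_null (by simpa using hx) (massMeasure_lt m _)

theorem massMeasure_real {m : ℕ} {a : ℕ → ℝ} (ha : ∀ x ≤ m, 0 ≤ a x) (S : Set ℕ) :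
    (massMeasure m a).real S = ∑ x ∈ Finset.range (m + 1), S.indicator 1 x * a x := by
  rw [← integral_massMeasure ha, integral_indicator_one (MeasurableSet.of_discrete)]

theorem tvDist_massMeasure_le {m : ℕ} {a b : ℕ → ℝ} (ha : ∀ x ≤ m, 0 ≤ a x)
    (hb : ∀ x ≤ m, 0 ≤ b x) : tvDist (massMeasure m a) (massMeasure m b)
      ≤ ∑ x ∈ Finset.range (m + 1), |a x - b x| := by
  have : Nonempty {S : Set ℕ // MeasurableSet S} := ⟨⟨∅, MeasurableSet.empty⟩⟩
  refine ciSup_le fun S ↦ ?_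
  rw [massMeasure_real ha, massMeasure_real hb, ← Finset.sum_sub_distrib]
  refine (Finset.abs_sum_le_sum_abs _ _).trans (Finset.sum_le_sum fun x _ ↦ ?_)
  by_cases hx : x ∈ S.1 <;> simp [hx]

theorem chiSqDiv_massMeasure {m : ℕ} {a b : ℕ → ℝ} (ha : ∀ x ≤ m, 0 ≤ a x)
    (hb : ∀ x ≤ m, 0 < b x) : chiSqDiv (massMeasure m a) (massMeasure m b)
      = ENNReal.ofReal (∑ x ∈ Finset.range (m + 1), a x ^ 2 / b x) - 1 := by
  unfold chiSqDiv
  congr 1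
  rw [tsum_eq_sum (s := Finset.range (m + 1)), ENNReal.ofReal_sum_of_nonneg]
  · refine Finset.sum_congr rfl fun x hx ↦ ?_
    have hx' := Nat.lt_succ_iff.mp (Finset.mem_range.mp hx)
    rw [massMeasure_singleton _ hx', massMeasure_singleton _ hx',
      ENNReal.ofReal_div_of_pos (hb x hx'), ENNReal.ofReal_pow (ha x hx')]
  · intro x hx
    have hx' := Nat.lt_succ_iff.mp (Finset.mem_range.mp hx)
    have := hb x hx'
    positivity
  · intro x hx
    have : massMeasure m a {x} = 0 :=
      measure_mono_null (by simp at hx ⊢; omega) (massMeasure_lt m a)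
    simp [this]

/-! ### Signed mixtures of binomial distributions -/

/-- A signed mixture of binomial distributions whose mixing measure has the first `k` moments of
the point mass at `1 / 2` has the first `k` moments of the fair binomial distribution. -/
theorem sum_pow_mul_mixture {ι : Type*} (s : Finset ι) (c u : ι → ℝ) {m k : ℕ}
    (hmom : ∀ q ≤ k, ∑ i ∈ s, c i * u i ^ q = 0 ^ q) {i : ℕ} (hi : i ≤ k) :
    ∑ x ∈ Finset.range (m + 1), (x : ℝ) ^ i * ∑ j ∈ s, c j * biasedBin m (u j) x
      = ∑ x ∈ Finset.range (m + 1), (x : ℝ) ^ i * biasedBin m 0 x := by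
  obtain ⟨Q, hd, hQ⟩ := exists_polynomial_moment i m
  rw [hQ]
  have h1 : ∑ x ∈ Finset.range (m + 1), (x : ℝ) ^ i * ∑ j ∈ s, c j * biasedBin m (u j) x
      = ∑ j ∈ s, c j * Q.eval (u j) := by
    simp only [← hQ, Finset.mul_sum]
    rw [Finset.sum_comm]
    exact Finset.sum_congr rfl fun j _ ↦ Finset.sum_congr rfl fun x _ ↦ by ring
  rw [h1]
  simp only [Polynomial.eval_eq_sum_range' (Nat.lt_succ_of_le hd), Finset.mul_sum]
  rw [Finset.sum_comm]
  refine Finset.sum_congr rfl fun q hq ↦ ?_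
  rw [← hmom q ((Nat.lt_succ_iff.mp (Finset.mem_range.mp hq)).trans hi), Finset.mul_sum]
  exact Finset.sum_congr rfl fun j _ ↦ by ring

/-- Reduces the construction to real numbers: nonnegative masses, moments of the mixing measure and
a χ² sum. Each binomial has mass 1, so the correction costs at most ∑|cᵢ| in total variation. -/
theorem exists_measure_of_mixture {ι : Type*} (s : Finset ι) (c u : ι → ℝ) {m k : ℕ} {v p : ℝ}
    (hp : p ∈ Set.Icc (0 : ℝ) 1) (hv : p = (1 + v) / 2) (hu : ∀ i ∈ s, |u i| ≤ 1)
    (hpos : ∀ x ≤ m, 0 ≤ biasedBin m v x + ∑ i ∈ s, c i * biasedBin m (u i) x)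
    (hmom : ∀ q ≤ k, v ^ q + ∑ i ∈ s, c i * u i ^ q = 0 ^ q) :
    ∃ A : Measure ℕ, IsProbabilityMeasure A ∧ A {x : ℕ | m < x} = 0 ∧
      (∀ i : ℕ, 1 ≤ i → i ≤ k →
        ∫ x : ℕ, (x : ℝ) ^ i ∂A = ∫ x : ℕ, (x : ℝ) ^ i ∂(binDist m (1 / 2) half_mem_Icc)) ∧
      tvDist A (binDist m p hp) ≤ ∑ i ∈ s, |c i| ∧
      chiSqDiv A (binDist m (1 / 2) half_mem_Icc) = ENNReal.ofReal
        (∑ x ∈ Finset.range (m + 1),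
          (biasedBin m v x + ∑ i ∈ s, c i * biasedBin m (u i) x) ^ 2 / biasedBin m 0 x) - 1 := by
  have hv1 : |v| ≤ 1 := by
    obtain ⟨h1, h2⟩ := hp
    rw [abs_le]; constructor <;> linarith
  have hhalf : massMeasure m (biasedBin m 0) = binDist m (1 / 2) half_mem_Icc :=
    massMeasure_biasedBin _ (by norm_num)
  have h0 : ∀ x ≤ m, 0 ≤ biasedBin m 0 x := fun x hx ↦ (biasedBin_zero_pos hx).le
  rw [← hhalf, ← massMeasure_biasedBin hp hv]
  have hM : ∀ i ≤ k, ∑ x ∈ Finset.range (m + 1), (x : ℝ) ^ i *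
        (biasedBin m v x + ∑ i ∈ s, c i * biasedBin m (u i) x)
      = ∑ x ∈ Finset.range (m + 1), (x : ℝ) ^ i * biasedBin m 0 x := by
    intro i hi
    -- The index `none` stands for the main component, of weight 1 and bias v.
    have := sum_pow_mul_mixture (m := m) (k := k) (Finset.insertNone s)
      (fun o ↦ o.elim 1 c) (fun o ↦ o.elim v u) (fun q hq ↦ by simpa using hmom q hq) hi
    simpa using this
  refine ⟨massMeasure m fun x ↦ biasedBin m v x + ∑ i ∈ s, c i * biasedBin m (u i) x,
    isProbabilityMeasure_massMeasure hpos ?_, massMeasure_lt _ _, fun i _ hi ↦ ?_, ?_, ?_⟩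
  · simpa [sum_biasedBin] using hM 0 (Nat.zero_le _)
  · rw [integral_massMeasure hpos, integral_massMeasure h0, hM i hi]
  · refine (tvDist_massMeasure_le hpos fun x _ ↦ biasedBin_nonneg hv1).trans ?_
    simp only [add_sub_cancel_left]
    calc ∑ x ∈ Finset.range (m + 1), |∑ i ∈ s, c i * biasedBin m (u i) x|
        ≤ ∑ x ∈ Finset.range (m + 1), ∑ i ∈ s, |c i| * biasedBin m (u i) x := by
          refine Finset.sum_le_sum fun x _ ↦ (Finset.abs_sum_le_sum_abs _ _).trans ?_
          refine Finset.sum_le_sum fun i hi ↦ ?_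
          rw [abs_mul, abs_of_nonneg (biasedBin_nonneg (hu i hi))]
      _ = ∑ i ∈ s, |c i| := by
          rw [Finset.sum_comm]
          refine Finset.sum_congr rfl fun i _ ↦ ?_
          rw [← Finset.mul_sum, sum_biasedBin, mul_one]
  · exact chiSqDiv_massMeasure hpos fun x hx ↦ biasedBin_zero_pos hx

/-! ### Lagrange weights at the squares -/

/-- The value at `t` of the Lagrange basis polynomial of the node `l ^ 2` among the nodes
`1 ^ 2, …, n ^ 2`. -/
noncomputable def squareWeight (n : ℕ) (t : ℝ) (l : ℕ) : ℝ :=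
  ∏ j ∈ (Finset.Icc 1 n).erase l, (t - (j : ℝ) ^ 2) / ((l : ℝ) ^ 2 - (j : ℝ) ^ 2)

theorem sum_squareWeight_mul_pow {n q : ℕ} (hq : q < n) (t : ℝ) :
    ∑ l ∈ Finset.Icc 1 n, squareWeight n t l * ((l : ℝ) ^ 2) ^ q = t ^ q := by
  classical
  have hinj : Set.InjOn (fun j : ℕ ↦ (j : ℝ) ^ 2) (Finset.Icc 1 n : Finset ℕ) := by
    intro a _ b _ h
    have h' : (a : ℝ) ^ 2 = (b : ℝ) ^ 2 := h
    have := (pow_left_inj₀ (Nat.cast_nonneg a) (Nat.cast_nonneg b) two_ne_zero).mp h'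
    exact_mod_cast this
  have h := Lagrange.eq_interpolate (f := (Polynomial.X ^ q : Polynomial ℝ)) hinj (by
    rw [Polynomial.degree_X_pow, Nat.card_Icc]
    exact_mod_cast hq)
  have h2 := congrArg (Polynomial.eval t) h
  rw [Polynomial.eval_pow, Polynomial.eval_X] at h2
  rw [h2, Lagrange.interpolate_apply, Polynomial.eval_finsetSum]
  refine Finset.sum_congr rfl fun l _ ↦ ?_
  rw [Polynomial.eval_mul, Polynomial.eval_C, Polynomial.eval_pow, Polynomial.eval_X, mul_comm,
    squareWeight, Lagrange.basis, Polynomial.eval_prod]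
  congr 1
  refine Finset.prod_congr rfl fun j _ ↦ ?_
  simp only [Lagrange.basisDivisor, Polynomial.eval_mul, Polynomial.eval_C, Polynomial.eval_sub,
    Polynomial.eval_X]
  rw [div_eq_inv_mul]

/-- With l = r + 1, factor l² - j² = (l - j)(l + j); the two products over j are r! and
(2r+1)!/(r+1)!. -/
theorem prod_div_sq_sub_sq_self (r : ℕ) :
    (∏ j ∈ Finset.range r, ((j : ℝ) + 1) ^ 2 / |((r : ℝ) + 1) ^ 2 - ((j : ℝ) + 1) ^ 2|)
      * ((2 * r + 2).factorial : ℝ) = 2 * ((r + 1).factorial : ℝ) ^ 2 := by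
  have h1 : ∏ j ∈ Finset.range r, ((j : ℝ) + 1) = r.factorial := by
    rw [← Finset.prod_range_add_one_eq_factorial]; push_cast; rfl
  have h2 : ∏ j ∈ Finset.range r, ((r : ℝ) - j) = r.factorial := by
    rw [← Nat.descFactorial_self, Nat.descFactorial_eq_prod_range]
    push_cast
    refine Finset.prod_congr rfl fun j hj ↦ ?_
    rw [Nat.cast_sub (Finset.mem_range.mp hj).le]
  have h3 : ((r + 1).factorial : ℝ) * ∏ j ∈ Finset.range r, ((r : ℝ) + 2 + j)
      = (2 * r + 1).factorial := by
    have h := Nat.factorial_mul_ascFactorial (r + 1) r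
    rw [Nat.ascFactorial_eq_prod_range, show r + 1 + r = 2 * r + 1 by ring] at h
    rw [← h]
    push_cast
    congr 1
    refine Finset.prod_congr rfl fun j _ ↦ by ring
  have h4 : ∏ j ∈ Finset.range r, ((j : ℝ) + 1) ^ 2 / |((r : ℝ) + 1) ^ 2 - ((j : ℝ) + 1) ^ 2|
      = (r.factorial : ℝ) ^ 2 / (r.factorial * ∏ j ∈ Finset.range r, ((r : ℝ) + 2 + j)) := by
    rw [Finset.prod_div_distrib, Finset.prod_pow, h1, ← h2, ← Finset.prod_mul_distrib]
    congr 1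
    refine Finset.prod_congr rfl fun j hj ↦ ?_
    have hj' : (j : ℝ) < r := by exact_mod_cast Finset.mem_range.mp hj
    rw [abs_of_nonneg (by nlinarith [Nat.cast_nonneg (α := ℝ) j])]
    ring
  have hP : 0 < ∏ j ∈ Finset.range r, ((r : ℝ) + 2 + j) :=
    Finset.prod_pos fun j _ ↦ by positivity
  have hr : (0 : ℝ) < r.factorial := by exact_mod_cast r.factorial_pos
  rw [h4, Nat.factorial_succ (2 * r + 1), Nat.factorial_succ r]
  rw [Nat.factorial_succ r] at h3
  push_cast at h3 ⊢
  rw [← h3]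
  field_simp
  ring

/-- Induction on the number d of nodes beyond l: the new node j = l + d + 1 contributes j² /
((d+1)(2l+d+1)), exactly the change in the factorials. -/
theorem prod_div_sq_sub_sq {l : ℕ} (hl : 1 ≤ l) (d : ℕ) :
    (∏ j ∈ (Finset.Icc 1 (l + d)).erase l, (j : ℝ) ^ 2 / |(l : ℝ) ^ 2 - (j : ℝ) ^ 2|)
      * ((d.factorial : ℝ) * (2 * l + d).factorial) = 2 * ((l + d).factorial : ℝ) ^ 2 := by
  induction d with
  | zero =>
    obtain ⟨r, rfl⟩ : ∃ r, l = r + 1 := ⟨l - 1, by omega⟩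
    have h : (Finset.Icc 1 (r + 1 + 0)).erase (r + 1)
        = (Finset.range r).map (addRightEmbedding 1) := by
      ext j
      simp only [Finset.mem_erase, Finset.mem_Icc, Finset.mem_map, Finset.mem_range,
        addRightEmbedding_apply]
      constructor
      · rintro ⟨h1, h2, h3⟩; exact ⟨j - 1, by omega, by omega⟩
      · rintro ⟨a, ha, rfl⟩; omega
    rw [h, Finset.prod_map]
    simpa [mul_add] using prod_div_sq_sub_sq_self r
  | succ d ih =>
    have h : (Finset.Icc 1 (l + (d + 1))).erase l
        = insert (l + (d + 1)) ((Finset.Icc 1 (l + d)).erase l) := by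
      ext j
      simp only [Finset.mem_erase, Finset.mem_Icc, Finset.mem_insert]
      omega
    rw [h, Finset.prod_insert (by simp)]
    rw [← add_assoc, ← add_assoc, Nat.factorial_succ d, Nat.factorial_succ (2 * l + d),
      Nat.factorial_succ (l + d)]
    have habs : |(l : ℝ) ^ 2 - ((l + d + 1 : ℕ) : ℝ) ^ 2| = (d + 1) * (2 * l + d + 1) := by
      rw [abs_of_nonpos]
      · push_cast; ring
      · push_cast; nlinarith [Nat.cast_nonneg (α := ℝ) l, Nat.cast_nonneg (α := ℝ) d]
    rw [habs]
    push_cast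
    have e : ∀ a b c p e f : ℝ, b ≠ 0 → c ≠ 0 →
        a / (b * c) * p * (b * e * (c * f)) = a * (p * (e * f)) := by
      intros; field_simp
    rw [e _ _ _ _ _ _ (by positivity) (by positivity), ih]
    ring

/-- With N = l + d, the product is 2 N!² / (d! (2N-d)!) = 2 C(2N, d) / C(2N, N), and the central
binomial coefficient is the largest. -/
theorem prod_div_sq_sub_sq_le_two {l n : ℕ} (hl : 1 ≤ l) (hn : l ≤ n) :
    ∏ j ∈ (Finset.Icc 1 n).erase l, (j : ℝ) ^ 2 / |(l : ℝ) ^ 2 - (j : ℝ) ^ 2| ≤ 2 := by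
  obtain ⟨d, rfl⟩ := Nat.exists_eq_add_of_le hn
  have h := prod_div_sq_sub_sq hl d
  have h1 : ((l + d).factorial : ℝ) ^ 2 ≤ (d.factorial : ℝ) * (2 * l + d).factorial := by
    have hc := Nat.choose_le_centralBinom d (l + d)
    have h2 := Nat.choose_mul_factorial_mul_factorial (n := 2 * (l + d)) (k := d) (by omega)
    have h3 := Nat.choose_mul_factorial_mul_factorial (n := 2 * (l + d)) (k := l + d) (by omega)
    rw [show 2 * (l + d) - d = 2 * l + d by omega] at h2
    rw [show 2 * (l + d) - (l + d) = l + d by omega] at h3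
    rw [Nat.centralBinom] at hc
    have hpos : 0 < (2 * (l + d)).choose d := Nat.choose_pos (by omega)
    have : (l + d).factorial ^ 2 ≤ d.factorial * (2 * l + d).factorial := by
      refine Nat.le_of_mul_le_mul_left ?_ hpos
      calc _ ≤ (2 * (l + d)).choose (l + d) * (l + d).factorial ^ 2 :=
            Nat.mul_le_mul_right _ hc
        _ = _ := by rw [← mul_assoc, h2, ← h3]; ring
    exact_mod_cast this
  have hpos : (0 : ℝ) < (d.factorial : ℝ) * (2 * l + d).factorial := by positivity
  refine le_of_mul_le_mul_right ?_ hpos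
  rw [h]
  linarith

theorem abs_squareWeight_le {n l : ℕ} {t : ℝ} (ht0 : 0 ≤ t) (ht1 : t ≤ 1) (hl : 1 ≤ l)
    (hn : l ≤ n) : |squareWeight n t l| ≤ 2 := by
  refine le_trans ?_ (prod_div_sq_sub_sq_le_two hl hn)
  rw [squareWeight, Finset.abs_prod]
  refine Finset.prod_le_prod (fun _ _ ↦ abs_nonneg _) fun j hj ↦ ?_
  have hj1 : (1 : ℝ) ≤ (j : ℝ) ^ 2 := by
    have : (1 : ℝ) ≤ j := by
      exact_mod_cast (Finset.mem_Icc.mp (Finset.mem_of_mem_erase hj)).1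
    nlinarith
  rw [abs_div]
  gcongr
  rw [abs_le]
  constructor <;> linarith

/-- For odd n the n - 1 negative numerators t - j² have positive product, and each factor has
absolute value at least (1/2)/n². This positivity is why n is taken odd. -/
theorem le_squareWeight_self {n : ℕ} {t : ℝ} (hn : Odd n) (ht0 : 0 ≤ t) (ht : t ≤ 1 / 2) :
    (1 / (2 * (n : ℝ) ^ 2)) ^ n ≤ squareWeight n t n := by
  have hn1 : 1 ≤ n := hn.pos
  have hnR : (1 : ℝ) ≤ n := by exact_mod_cast hn1
  have hmem : n ∈ Finset.Icc 1 n := by simp [hn1]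
  have hcard : ((Finset.Icc 1 n).erase n).card = n - 1 := by
    rw [Finset.card_erase_of_mem hmem, Nat.card_Icc]; omega
  have hpar : (-1 : ℝ) ^ (n - 1) = 1 := by
    apply Even.neg_one_pow
    obtain ⟨r, rfl⟩ := hn
    simp
  have heq : squareWeight n t n = ∏ j ∈ (Finset.Icc 1 n).erase n,
      (((j : ℝ) ^ 2 - t) / ((n : ℝ) ^ 2 - (j : ℝ) ^ 2)) := by
    have : squareWeight n t n = ∏ j ∈ (Finset.Icc 1 n).erase n,
      (-1) * (((j : ℝ) ^ 2 - t) / ((n : ℝ) ^ 2 - (j : ℝ) ^ 2)) := by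
      refine Finset.prod_congr rfl fun j _ ↦ ?_
      rw [← mul_div_assoc]; congr 1; ring
    rw [this, Finset.prod_mul_distrib, Finset.prod_const, hcard, hpar, one_mul]
  rw [heq]
  have hle1 : 1 / (2 * (n : ℝ) ^ 2) ≤ 1 := by
    rw [div_le_one (by positivity)]; nlinarith
  calc (1 / (2 * (n : ℝ) ^ 2)) ^ n ≤ (1 / (2 * (n : ℝ) ^ 2)) ^ (n - 1) :=
        pow_le_pow_of_le_one (by positivity) hle1 (by omega)
    _ = ∏ j ∈ (Finset.Icc 1 n).erase n, (1 / (2 * (n : ℝ) ^ 2)) := by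
        rw [Finset.prod_const, hcard]
    _ ≤ _ := by
        refine Finset.prod_le_prod (fun _ _ ↦ by positivity) fun j hj ↦ ?_
        have hj' := Finset.mem_erase.mp hj
        have hj2 := Finset.mem_Icc.mp hj'.2
        have hj1 : (1 : ℝ) ≤ j := by exact_mod_cast hj2.1
        have hjn : (j : ℝ) < n := by exact_mod_cast lt_of_le_of_ne hj2.2 hj'.1
        have hd : 0 < (n : ℝ) ^ 2 - (j : ℝ) ^ 2 := by nlinarith
        rw [div_le_div_iff₀ (by positivity) hd]
        have h1 : 1 / 2 ≤ (j : ℝ) ^ 2 - t := by nlinarith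
        nlinarith [mul_le_mul_of_nonneg_right h1 (sq_nonneg (n : ℝ))]

/-! ### Estimates for the density (1+u)^x (1-u)^y -/

theorem tilt_le_exp {u : ℝ} (hu : |u| ≤ 1) (x y : ℕ) :
    (1 + u) ^ x * (1 - u) ^ y ≤ Real.exp (((x : ℝ) - y) * u) := by
  rw [abs_le] at hu
  have h1 : (1 + u) ^ x ≤ Real.exp (x * u) := by
    rw [Real.exp_nat_mul]
    exact pow_le_pow_left₀ (by linarith) (by linarith [Real.add_one_le_exp u]) x
  have h2 : (1 - u) ^ y ≤ Real.exp (y * (-u)) := by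
    rw [Real.exp_nat_mul]
    exact pow_le_pow_left₀ (by linarith) (by linarith [Real.add_one_le_exp (-u)]) y
  have h3 : ((x : ℝ) - y) * u = x * u + y * (-u) := by ring
  rw [h3, Real.exp_add]
  exact mul_le_mul h1 h2 (pow_nonneg (by linarith) _) (Real.exp_pos _).le

/-- The logarithm of the density is concave in u, hence lies below its tangent at U; the exponent is
(u - U) times the derivative there. -/
theorem tilt_le_tilt_mul_exp {u U : ℝ} (hu : |u| ≤ 1) (hU : |U| < 1) (x y : ℕ) :
    (1 + u) ^ x * (1 - u) ^ y ≤ (1 + U) ^ x * (1 - U) ^ y *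
      Real.exp ((u - U) * (((x : ℝ) - y) - (x + y) * U) / (1 - U ^ 2)) := by
  rw [abs_le] at hu
  rw [abs_lt] at hU
  have hU1 : 0 < 1 + U := by linarith
  have hU2 : 0 < 1 - U := by linarith
  have h1 : (1 + u) ^ x ≤ (1 + U) ^ x * Real.exp (x * ((u - U) / (1 + U))) := by
    rw [Real.exp_nat_mul, ← mul_pow]
    refine pow_le_pow_left₀ (by linarith) ?_ x
    calc 1 + u = (1 + U) * ((u - U) / (1 + U) + 1) := by field_simp; ring
      _ ≤ _ := mul_le_mul_of_nonneg_left (Real.add_one_le_exp _) hU1.le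
  have h2 : (1 - u) ^ y ≤ (1 - U) ^ y * Real.exp (y * ((U - u) / (1 - U))) := by
    rw [Real.exp_nat_mul, ← mul_pow]
    refine pow_le_pow_left₀ (by linarith) ?_ y
    calc 1 - u = (1 - U) * ((U - u) / (1 - U) + 1) := by field_simp; ring
      _ ≤ _ := mul_le_mul_of_nonneg_left (Real.add_one_le_exp _) hU2.le
  have h3 : (u - U) * (((x : ℝ) - y) - (x + y) * U) / (1 - U ^ 2)
      = x * ((u - U) / (1 + U)) + y * ((U - u) / (1 - U)) := by
    have : (1 - U ^ 2) = (1 + U) * (1 - U) := by ring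
    rw [this]
    field_simp
    ring
  rw [h3, Real.exp_add]
  calc _ ≤ ((1 + U) ^ x * Real.exp (x * ((u - U) / (1 + U)))) *
        ((1 - U) ^ y * Real.exp (y * ((U - u) / (1 - U)))) :=
        mul_le_mul h1 h2 (pow_nonneg (by linarith) _) (by positivity)
    _ = _ := by ring

/-- Under these hypotheses the logarithmic derivative at U is at least Z/2, so a node lying D below
U loses a factor exp(DZ/2). -/
theorem tilt_le_of_gap {u U D Z : ℝ} (hu : |u| ≤ 1) (hU0 : 0 ≤ U) (hU : U < 1) (hD : 0 ≤ D)
    (huU : u + D ≤ U) {x y : ℕ} (hZ : Z ≤ (x : ℝ) - y) (hZ0 : 0 ≤ Z)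
    (hUZ : ((x : ℝ) + y) * U ≤ Z / 2) :
    (1 + u) ^ x * (1 - u) ^ y ≤ (1 + U) ^ x * (1 - U) ^ y * Real.exp (-(D * Z / 2)) := by
  refine (tilt_le_tilt_mul_exp hu (by rwa [abs_of_nonneg hU0]) x y).trans ?_
  have h1 : 0 ≤ (1 + U) ^ x * (1 - U) ^ y :=
    mul_nonneg (pow_nonneg (by linarith) _) (pow_nonneg (by linarith) _)
  refine mul_le_mul_of_nonneg_left (Real.exp_le_exp.mpr ?_) h1
  have h2 : 0 < 1 - U ^ 2 := by nlinarith
  rw [div_le_iff₀ h2]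
  have h3 : Z / 2 ≤ ((x : ℝ) - y) - (x + y) * U := by linarith
  have h4 : D * (Z / 2) ≤ (U - u) * (((x : ℝ) - y) - (x + y) * U) :=
    mul_le_mul (by linarith) h3 (by linarith) (by linarith)
  have h5 : 0 ≤ D * Z := mul_nonneg hD hZ0
  nlinarith [mul_nonneg h5 (sq_nonneg U)]

theorem sum_tilt_nonneg_of_dominant {ι : Type*} {s : Finset ι} {c u : ι → ℝ}
    {i₀ : ι} (hi₀ : i₀ ∈ s) {D Z : ℝ} (hu : ∀ i ∈ s, |u i| ≤ 1) (hU0 : 0 ≤ u i₀) (hU : u i₀ < 1)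
    (hD : 0 ≤ D) (hgap : ∀ i ∈ s, i ≠ i₀ → u i + D ≤ u i₀) {x y : ℕ} (hZ : Z ≤ (x : ℝ) - y)
    (hZ0 : 0 ≤ Z) (hUZ : ((x : ℝ) + y) * u i₀ ≤ Z / 2)
    (hc : ∑ i ∈ s, |c i| ≤ c i₀ * Real.exp (D * Z / 2)) :
    0 ≤ ∑ i ∈ s, c i * ((1 + u i) ^ x * (1 - u i) ^ y) := by
  classical
  set R : ι → ℝ := fun i ↦ (1 + u i) ^ x * (1 - u i) ^ y with hR
  have hR0 : ∀ i ∈ s, 0 ≤ R i := fun i hi ↦ by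
    have := abs_le.mp (hu i hi)
    exact mul_nonneg (pow_nonneg (by linarith) _) (pow_nonneg (by linarith) _)
  change 0 ≤ ∑ i ∈ s, c i * R i
  rw [← Finset.add_sum_erase s _ hi₀]
  have h1 : -(∑ i ∈ s.erase i₀, |c i|) * (R i₀ * Real.exp (-(D * Z / 2)))
      ≤ ∑ i ∈ s.erase i₀, c i * R i := by
    rw [neg_mul, Finset.sum_mul, ← Finset.sum_neg_distrib]
    refine Finset.sum_le_sum fun i hi ↦ ?_
    have his := Finset.mem_of_mem_erase hi
    have h := tilt_le_of_gap (hu i his) hU0 hU hD (hgap i his (Finset.ne_of_mem_erase hi))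
      hZ hZ0 hUZ
    have h' : |c i| * R i ≤ |c i| * (R i₀ * Real.exp (-(D * Z / 2))) :=
      mul_le_mul_of_nonneg_left h (abs_nonneg _)
    have h'' : -|c i| * R i ≤ c i * R i :=
      mul_le_mul_of_nonneg_right (neg_abs_le _) (hR0 i his)
    linarith
  have h2 : ∑ i ∈ s.erase i₀, |c i| ≤ ∑ i ∈ s, |c i| :=
    Finset.sum_le_sum_of_subset_of_nonneg (Finset.erase_subset _ _) fun _ _ _ ↦ abs_nonneg _
  have h3 : (∑ i ∈ s.erase i₀, |c i|) * (R i₀ * Real.exp (-(D * Z / 2))) ≤ c i₀ * R i₀ := by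
    calc _ ≤ (c i₀ * Real.exp (D * Z / 2)) * (R i₀ * Real.exp (-(D * Z / 2))) :=
          mul_le_mul_of_nonneg_right (h2.trans hc)
            (mul_nonneg (hR0 _ hi₀) (Real.exp_pos _).le)
      _ = c i₀ * R i₀ * (Real.exp (D * Z / 2) * Real.exp (-(D * Z / 2))) := by ring
      _ = c i₀ * R i₀ := by rw [← Real.exp_add, add_neg_cancel, Real.exp_zero, mul_one]
  linarith

theorem half_le_tilt {v Z : ℝ} (hv0 : 0 ≤ v) (hv : v ≤ 1 / 2) {x y : ℕ}
    (hZ : |(x : ℝ) - y| ≤ Z) (h : v * (Z + (x + y) * v) ≤ 3 / 8) :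
    1 / 2 ≤ (1 + v) ^ x * (1 - v) ^ y := by
  have h1 := tilt_le_tilt_mul_exp (u := 0) (U := v) (by simp)
    (by rw [abs_of_nonneg hv0]; linarith) x y
  simp only [add_zero, sub_zero, one_pow, mul_one, zero_sub] at h1
  have hR : 0 ≤ (1 + v) ^ x * (1 - v) ^ y :=
    mul_nonneg (pow_nonneg (by linarith) _) (pow_nonneg (by linarith) _)
  have h2 : Real.exp (-v * (((x : ℝ) - y) - (x + y) * v) / (1 - v ^ 2)) ≤ 2 := by
    -- Since v ≤ 1/2, the denominator is at least 3/4, and (3/8)/(3/4) = 1/2 < log 2.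
    have : -v * (((x : ℝ) - y) - (x + y) * v) / (1 - v ^ 2) ≤ 1 / 2 := by
      rw [div_le_iff₀ (by nlinarith)]
      have h3 : -v * (((x : ℝ) - y) - (x + y) * v) ≤ v * (Z + (x + y) * v) := by
        nlinarith [(abs_le.mp hZ).1, mul_le_mul_of_nonneg_left (abs_le.mp hZ).1 hv0]
      nlinarith
    refine (Real.exp_le_exp.mpr (this.trans (?_ : (1 / 2 : ℝ) ≤ Real.log 2))).trans
      (Real.exp_log two_pos).le
    linarith [Real.log_two_gt_d9]
  have h3 := mul_le_mul_of_nonneg_left h2 hR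
  linarith

theorem tilt_add_sum_nonneg {ι : Type*} {s : Finset ι} {c u : ι → ℝ} {v Z B : ℝ} {x y : ℕ}
    (hv0 : 0 ≤ v) (hv : v ≤ 1 / 2) (hZ : |(x : ℝ) - y| ≤ Z)
    (hvZ : v * (Z + (x + y) * v) ≤ 3 / 8) (hu : ∀ i ∈ s, |u i| ≤ 1) (huB : ∀ i ∈ s, |u i| ≤ B)
    (hc : (∑ i ∈ s, |c i|) * Real.exp (Z * B) ≤ 1 / 2) :
    0 ≤ (1 + v) ^ x * (1 - v) ^ y + ∑ i ∈ s, c i * ((1 + u i) ^ x * (1 - u i) ^ y) := by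
  have h1 := half_le_tilt hv0 hv hZ hvZ
  have h2 : |∑ i ∈ s, c i * ((1 + u i) ^ x * (1 - u i) ^ y)| ≤ 1 / 2 := by
    refine ((Finset.abs_sum_le_sum_abs _ _).trans ?_).trans hc
    rw [Finset.sum_mul]
    refine Finset.sum_le_sum fun i hi ↦ ?_
    have hb := abs_le.mp (hu i hi)
    rw [abs_mul, abs_of_nonneg (a := (1 + u i) ^ x * (1 - u i) ^ y)
      (mul_nonneg (pow_nonneg (by linarith) _) (pow_nonneg (by linarith) _))]
    refine mul_le_mul_of_nonneg_left ((tilt_le_exp (hu i hi) x y).trans ?_) (abs_nonneg _)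
    refine Real.exp_le_exp.mpr ((le_abs_self _).trans ?_)
    rw [abs_mul]
    exact mul_le_mul hZ (huB i hi) (abs_nonneg _) ((abs_nonneg _).trans hZ)
  linarith [(abs_le.mp h2).1]

/-! ### The mixing measure -/

/-- The sign `±1` attached to a boolean. -/
def boolSign (b : Bool) : ℝ := if b then 1 else -1

/-- The index set of the nodes of the mixing measure. -/
def mixIndex (n : ℕ) : Finset (Bool × ℕ) := Finset.univ ×ˢ insert 0 (Finset.Icc 1 n)

/-- The symmetric nodes `±v₀` and `±lα`. -/
noncomputable def mixNode (v₀ α : ℝ) (i : Bool × ℕ) : ℝ :=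
  boolSign i.1 * if i.2 = 0 then v₀ else i.2 * α

/-- The weights of a signed measure on the nodes `mixNode` which has small total mass, matches
the moments of `δ_{-v₀} - δ_{v₀}`, and is positive at the two extreme nodes. -/
noncomputable def mixWeight (n : ℕ) (v₀ α : ℝ) (i : Bool × ℕ) : ℝ :=
  if i.2 = 0 then -(2 * v₀ / (n * α))
  else squareWeight n (v₀ ^ 2 / α ^ 2) i.2 * (2 * v₀ / (n * α) - boolSign i.1 * (v₀ / (i.2 * α)))

theorem sum_mixIndex (n : ℕ) (F : Bool × ℕ → ℝ) : ∑ i ∈ mixIndex n, F i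
    = F (true, 0) + F (false, 0) + ∑ l ∈ Finset.Icc 1 n, (F (true, l) + F (false, l)) := by
  rw [mixIndex, Finset.sum_product_right, Finset.sum_insert (by simp)]
  simp

/-- The antisymmetric part of the weights, ∓v₀/(lα) times the Lagrange weight, yields the odd
moments -2v₀^q. The symmetric part has vanishing even moments, because interpolation from the lα
cancels the nodes ±v₀; it is there only to make the extreme weights positive. -/
theorem sum_mixWeight_mul_pow {n q : ℕ} {v₀ α : ℝ} (hα : α ≠ 0) (hq : q ≤ n) (hn : 1 ≤ n) :
    v₀ ^ q + ∑ i ∈ mixIndex n, mixWeight n v₀ α i * mixNode v₀ α i ^ q = (-v₀) ^ q := by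
  have hterm : ∀ l ∈ Finset.Icc 1 n,
      mixWeight n v₀ α (true, l) * mixNode v₀ α (true, l) ^ q
        + mixWeight n v₀ α (false, l) * mixNode v₀ α (false, l) ^ q
      = squareWeight n (v₀ ^ 2 / α ^ 2) l * ((2 * v₀ / (n * α) - v₀ / (l * α)) * (l * α) ^ q
        + (2 * v₀ / (n * α) + v₀ / (l * α)) * (-(l * α)) ^ q) := by
    intro l hl
    have : l ≠ 0 := by have := (Finset.mem_Icc.mp hl).1; omega
    simp only [mixWeight, mixNode, boolSign, this, if_false, if_true, Bool.false_eq_true, one_mul,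
      neg_mul, sub_neg_eq_add]
    ring
  have hn0 : (n : ℝ) ≠ 0 := by exact_mod_cast (by omega : n ≠ 0)
  rw [sum_mixIndex, Finset.sum_congr rfl hterm]
  simp only [mixWeight, mixNode, boolSign, if_true, Bool.false_eq_true, if_false, one_mul,
    neg_mul]
  rcases Nat.even_or_odd' q with ⟨r, rfl | rfl⟩
  · have hev : Even (2 * r) := even_two_mul r
    have hs := sum_squareWeight_mul_pow (n := n) (q := r) (by omega) (v₀ ^ 2 / α ^ 2)
    have h2 : ∑ l ∈ Finset.Icc 1 n, squareWeight n (v₀ ^ 2 / α ^ 2) l *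
        ((2 * v₀ / (n * α) - v₀ / (l * α)) * (l * α) ^ (2 * r)
          + (2 * v₀ / (n * α) + v₀ / (l * α)) * (-(l * α)) ^ (2 * r))
        = (4 * v₀ / (n * α) * α ^ (2 * r)) * (v₀ ^ 2 / α ^ 2) ^ r := by
      rw [← hs, Finset.mul_sum]
      refine Finset.sum_congr rfl fun l _ ↦ ?_
      rw [hev.neg_pow, mul_pow, pow_mul (l : ℝ)]
      ring
    rw [h2, hev.neg_pow, div_pow, pow_mul, pow_mul]
    field_simp
    ring
  · have hod : Odd (2 * r + 1) := odd_two_mul_add_one r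
    have hs := sum_squareWeight_mul_pow (n := n) (q := r) (by omega) (v₀ ^ 2 / α ^ 2)
    have h2 : ∑ l ∈ Finset.Icc 1 n, squareWeight n (v₀ ^ 2 / α ^ 2) l *
        ((2 * v₀ / (n * α) - v₀ / (l * α)) * (l * α) ^ (2 * r + 1)
          + (2 * v₀ / (n * α) + v₀ / (l * α)) * (-(l * α)) ^ (2 * r + 1))
        = (-(2 * v₀) * α ^ (2 * r)) * (v₀ ^ 2 / α ^ 2) ^ r := by
      rw [← hs, Finset.mul_sum]
      refine Finset.sum_congr rfl fun l hl ↦ ?_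
      have hl0 : (l : ℝ) ≠ 0 := by
        have := (Finset.mem_Icc.mp hl).1
        exact_mod_cast (by omega : l ≠ 0)
      rw [hod.neg_pow, pow_succ ((l : ℝ) * α), mul_pow, pow_mul (l : ℝ)]
      field_simp
      ring
    rw [h2, hod.neg_pow, div_pow, pow_mul α, pow_succ v₀, pow_mul v₀]
    field_simp
    ring

/-- Translating all nodes by v₀ takes v₀ to 2v₀ and -v₀ to 0; by the binomial theorem, agreement of
moments up to order k survives translation. -/
theorem sum_mul_shift_pow {ι : Type*} {s : Finset ι} {c t : ι → ℝ} {v₀ : ℝ} {k : ℕ}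
    (h : ∀ q ≤ k, v₀ ^ q + ∑ i ∈ s, c i * t i ^ q = (-v₀) ^ q) {q : ℕ} (hq : q ≤ k) :
    (2 * v₀) ^ q + ∑ i ∈ s, c i * (v₀ + t i) ^ q = 0 ^ q := by
  have e1 : (2 * v₀) ^ q = (v₀ + v₀) ^ q := by ring
  have e2 : (0 : ℝ) ^ q = (-v₀ + v₀) ^ q := by rw [neg_add_cancel]
  rw [e1, e2]
  simp only [add_comm v₀ (t _), add_pow (_ : ℝ) v₀ q, Finset.mul_sum]
  rw [Finset.sum_comm, ← Finset.sum_add_distrib]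
  refine Finset.sum_congr rfl fun j hj ↦ ?_
  rw [← h j ((Nat.lt_succ_iff.mp (Finset.mem_range.mp hj)).trans hq), add_mul, add_mul,
    Finset.sum_mul, Finset.sum_mul]
  congr 1
  exact Finset.sum_congr rfl fun i _ ↦ by ring

theorem sum_abs_mixWeight_le {n : ℕ} {v₀ α : ℝ} (hv : 0 < v₀) (hα : v₀ ≤ α) (hn : 1 ≤ n) :
    ∑ i ∈ mixIndex n, |mixWeight n v₀ α i| ≤ 4 * (n + 1) ^ 2 * (v₀ / (n * α)) := by
  have hα0 : 0 < α := hv.trans_le hα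
  have hnR : (1 : ℝ) ≤ n := by exact_mod_cast hn
  set τ := v₀ / (n * α) with hτ
  have hτ0 : 0 < τ := by positivity
  have h2τ : 2 * v₀ / (n * α) = 2 * τ := by rw [hτ]; ring
  have ht1 : v₀ ^ 2 / α ^ 2 ≤ 1 := by
    rw [div_le_one (by positivity)]; exact pow_le_pow_left₀ hv.le hα 2
  have hterm : ∀ l ∈ Finset.Icc 1 n, |mixWeight n v₀ α (true, l)| + |mixWeight n v₀ α (false, l)|
      ≤ (8 + 4 * n) * τ := by
    intro l hl
    have hl' := Finset.mem_Icc.mp hl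
    have hl0 : l ≠ 0 := by omega
    have hl1 : (1 : ℝ) ≤ l := by exact_mod_cast hl'.1
    have hM := abs_squareWeight_le (n := n) (l := l) (by positivity) ht1 hl'.1 hl'.2
    have hb : v₀ / (l * α) ≤ n * τ := by
      have : n * τ = v₀ / α := by rw [hτ]; field_simp
      rw [this]
      gcongr
      nlinarith
    have hb0 : 0 ≤ v₀ / (l * α) := by positivity
    simp only [mixWeight, boolSign, hl0, if_false, if_true, Bool.false_eq_true, one_mul,
      neg_mul, sub_neg_eq_add, abs_mul, h2τ]
    rw [← mul_add]
    have h3 : |2 * τ - v₀ / (l * α)| ≤ 2 * τ + n * τ := by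
      rw [abs_le]; constructor <;> nlinarith
    have h4 : |2 * τ + v₀ / (l * α)| ≤ 2 * τ + n * τ := by
      rw [abs_le]; constructor <;> nlinarith
    calc _ ≤ 2 * ((2 * τ + n * τ) + (2 * τ + n * τ)) :=
          mul_le_mul hM (add_le_add h3 h4) (by positivity) (by norm_num)
      _ = _ := by ring
  rw [sum_mixIndex]
  have hs := Finset.sum_le_sum hterm
  rw [Finset.sum_const, Nat.card_Icc, Nat.add_sub_cancel, nsmul_eq_mul] at hs
  have h0 : ∀ b, |mixWeight n v₀ α (b, 0)| = 2 * τ := by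
    intro b
    simp only [mixWeight, if_true, h2τ, abs_neg]
    exact abs_of_pos (by positivity)
  rw [h0, h0]
  linarith

/-- At l = n the second factor is 2τ ∓ τ ≥ τ with τ = v₀/(nα): the symmetric part outweighs the
antisymmetric one for both signs. -/
theorem le_mixWeight_last {n : ℕ} {v₀ α : ℝ} (hv : 0 < v₀) (hα : 2 * v₀ ≤ α) (hn : Odd n)
    (b : Bool) : (1 / (2 * (n : ℝ) ^ 2)) ^ n * (v₀ / (n * α)) ≤ mixWeight n v₀ α (b, n) := by
  have hα0 : 0 < α := by linarith
  have hn0 : n ≠ 0 := hn.pos.ne'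
  have ht : v₀ ^ 2 / α ^ 2 ≤ 1 / 2 := by
    rw [div_le_iff₀ (by positivity)]; nlinarith
  have hM := le_squareWeight_self hn (by positivity) ht
  have h0 : 0 ≤ v₀ / (n * α) := by positivity
  have h2 : 2 * v₀ / (n * α) = 2 * (v₀ / (n * α)) := by ring
  simp only [mixWeight, hn0, if_false, h2]
  refine mul_le_mul hM ?_ h0 (le_trans (by positivity) hM)
  cases b <;> simp [boolSign] <;> linarith

theorem abs_mixNode_le {n : ℕ} {v₀ α : ℝ} (hv : 0 < v₀) (hα : v₀ ≤ n * α) (hα0 : 0 ≤ α)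
    {i : Bool × ℕ} (hi : i ∈ mixIndex n) : |mixNode v₀ α i| ≤ n * α := by
  obtain ⟨b, l⟩ := i
  have hl : l ≤ n := by
    simp only [mixIndex, Finset.mem_product, Finset.mem_insert, Finset.mem_Icc] at hi
    omega
  have hlR : (l : ℝ) ≤ n := by exact_mod_cast hl
  have hs : |boolSign b| = 1 := by cases b <;> simp [boolSign]
  rw [mixNode, abs_mul, hs, one_mul]
  split_ifs
  · rwa [abs_of_pos hv]
  · rw [abs_of_nonneg (by positivity)]
    gcongr

/-- Neighbouring nodes lα are α apart, and v₀ ≤ α/2 keeps ±v₀ at least α/2 away from the extremes,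
even when n = 1. -/
theorem mixNode_gap {n : ℕ} {v₀ α : ℝ} (hv : 0 < v₀) (hα : 2 * v₀ ≤ α) (hn : 1 ≤ n)
    {i : Bool × ℕ} (hi : i ∈ mixIndex n) (b : Bool) (hne : i ≠ (b, n)) :
    boolSign b * mixNode v₀ α i + α / 2 ≤ n * α := by
  have hα0 : 0 < α := by linarith
  have hnR : (1 : ℝ) ≤ n := by exact_mod_cast hn
  have h1 : α ≤ n * α := by nlinarith
  obtain ⟨b', l⟩ := i
  have hl : l ≤ n := by
    simp only [mixIndex, Finset.mem_product, Finset.mem_insert, Finset.mem_Icc] at hi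
    omega
  simp only [mixNode, ← mul_assoc]
  have hss : boolSign b * boolSign b' = if b' = b then 1 else -1 := by
    cases b <;> cases b' <;> simp [boolSign]
  rw [hss]
  split_ifs with h2 h3 h3
  · linarith
  · have : l ≠ n := fun h ↦ hne (by rw [h2, h])
    have hlR : (l : ℝ) + 1 ≤ n := by exact_mod_cast (by omega : l + 1 ≤ n)
    nlinarith
  · linarith
  · have : 0 ≤ (l : ℝ) * α := by positivity
    linarith

/-- The left side is at most 4^((n+1)²) ≤ 4^(4n²) ≤ exp(8n²), and 8n² ≤ L/(12n) is the hypothesis on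
L. -/
theorem mul_pow_le_exp {n : ℕ} (hn : 1 ≤ n) {L : ℝ} (hL : 96 * (n : ℝ) ^ 3 ≤ L) :
    4 * ((n : ℝ) + 1) ^ 2 * (2 * (n : ℝ) ^ 2) ^ n ≤ Real.exp (L / (12 * n)) := by
  have hnR : (1 : ℝ) ≤ n := by exact_mod_cast hn
  have h0 : (n : ℝ) + 1 ≤ 2 ^ n := by exact_mod_cast Nat.lt_two_pow_self (n := n)
  have h1 : ((n : ℝ) + 1) ^ 2 ≤ 4 ^ n := by
    calc ((n : ℝ) + 1) ^ 2 ≤ (2 ^ n) ^ 2 := by gcongr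
      _ = 4 ^ n := by rw [← pow_mul, mul_comm, pow_mul]; norm_num
  have h2 : 2 * (n : ℝ) ^ 2 ≤ 4 ^ (n + 1) := by
    have := pow_succ (4 : ℝ) n
    nlinarith
  have h4 : (4 : ℝ) ≤ Real.exp 2 := by
    have h : Real.exp 2 = Real.exp 1 * Real.exp 1 := by rw [← Real.exp_add]; norm_num
    nlinarith [Real.add_one_le_exp (1 : ℝ)]
  calc 4 * ((n : ℝ) + 1) ^ 2 * (2 * (n : ℝ) ^ 2) ^ n
      ≤ 4 * 4 ^ n * (4 ^ (n + 1)) ^ n := by gcongr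
    _ = 4 ^ (1 + n + (n + 1) * n) := by rw [pow_add 4 (1 + n), pow_add 4 1, pow_mul, pow_one]
    _ ≤ 4 ^ (4 * n ^ 2) := pow_le_pow_right₀ (by norm_num) (by nlinarith)
    _ ≤ Real.exp 2 ^ (4 * n ^ 2) := by gcongr
    _ = Real.exp ((4 * n ^ 2 : ℕ) * 2) := by rw [Real.exp_nat_mul]
    _ ≤ Real.exp (L / (12 * n)) := by
        refine Real.exp_le_exp.mpr ?_
        rw [le_div_iff₀ (by positivity)]
        push_cast
        nlinarith

/-! ### Chi-squared and total variation estimates -/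

theorem sum_sq_sub_div (m : ℕ) (v : ℝ) :
    ∑ x ∈ Finset.range (m + 1), (biasedBin m v x - biasedBin m 0 x) ^ 2 / biasedBin m 0 x
      = (1 + v * v) ^ m - 1 := by
  have h : ∀ x ∈ Finset.range (m + 1),
      (biasedBin m v x - biasedBin m 0 x) ^ 2 / biasedBin m 0 x
        = biasedBin m v x * biasedBin m v x / biasedBin m 0 x - 2 * biasedBin m v x
          + biasedBin m 0 x := by
    intro x hx
    have := biasedBin_zero_pos (Nat.lt_succ_iff.mp (Finset.mem_range.mp hx))
    field_simp
    ring
  rw [Finset.sum_congr rfl h, Finset.sum_add_distrib, Finset.sum_sub_distrib, ← Finset.mul_sum,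
    sum_biasedBin, sum_biasedBin, sum_biasedBin_mul_div]
  ring

/-- Cauchy–Schwarz with weights |cᵢ| leaves only the diagonal pairings (1 + uᵢ²)^m. -/
theorem sum_sq_mixture_div_le {ι : Type*} {s : Finset ι} {c u : ι → ℝ} {m : ℕ} {E : ℝ}
    (hE : ∀ i ∈ s, (1 + u i * u i) ^ m ≤ E) :
    ∑ x ∈ Finset.range (m + 1), (∑ i ∈ s, c i * biasedBin m (u i) x) ^ 2 / biasedBin m 0 x
      ≤ (∑ i ∈ s, |c i|) ^ 2 * E := by
  have h : ∀ x ∈ Finset.range (m + 1),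
      (∑ i ∈ s, c i * biasedBin m (u i) x) ^ 2 / biasedBin m 0 x ≤ (∑ i ∈ s, |c i|) *
        ∑ i ∈ s, |c i| * (biasedBin m (u i) x * biasedBin m (u i) x / biasedBin m 0 x) := by
    intro x hx
    have := biasedBin_zero_pos (Nat.lt_succ_iff.mp (Finset.mem_range.mp hx))
    have hcs := Finset.sum_sq_le_sum_mul_sum_of_sq_le_mul s
      (r := fun i ↦ c i * biasedBin m (u i) x) (f := fun i ↦ |c i|)
      (g := fun i ↦ |c i| * (biasedBin m (u i) x) ^ 2) (fun _ _ ↦ abs_nonneg _)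
      (fun _ _ ↦ by positivity) (fun i _ ↦ by rw [mul_pow, ← mul_assoc, ← sq, sq_abs])
    have heq : (∑ i ∈ s, |c i| * (biasedBin m (u i) x * biasedBin m (u i) x / biasedBin m 0 x))
        * biasedBin m 0 x = ∑ i ∈ s, |c i| * biasedBin m (u i) x ^ 2 := by
      rw [Finset.sum_mul]
      refine Finset.sum_congr rfl fun i _ ↦ ?_
      field_simp
    rw [div_le_iff₀ this, mul_assoc, heq]
    exact hcs
  refine (Finset.sum_le_sum h).trans ?_
  rw [← Finset.mul_sum, Finset.sum_comm, sq, mul_assoc]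
  refine mul_le_mul_of_nonneg_left ?_ (Finset.sum_nonneg fun _ _ ↦ abs_nonneg _)
  rw [Finset.sum_mul]
  refine Finset.sum_le_sum fun i hi ↦ ?_
  rw [← Finset.mul_sum, sum_biasedBin_mul_div]
  exact mul_le_mul_of_nonneg_left (hE i hi) (abs_nonneg _)

theorem sum_sq_add_mixture_div_le {ι : Type*} {s : Finset ι} {c u : ι → ℝ} {m : ℕ} {v E : ℝ}
    (hc : ∑ i ∈ s, c i = 0) (hE : ∀ i ∈ s, (1 + u i * u i) ^ m ≤ E) :
    ∑ x ∈ Finset.range (m + 1),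
        (biasedBin m v x + ∑ i ∈ s, c i * biasedBin m (u i) x) ^ 2 / biasedBin m 0 x
      ≤ 1 + 2 * ((1 + v * v) ^ m - 1) + 2 * ((∑ i ∈ s, |c i|) ^ 2 * E) := by
  have hsum : ∑ x ∈ Finset.range (m + 1), ∑ i ∈ s, c i * biasedBin m (u i) x = 0 := by
    rw [Finset.sum_comm]
    simp only [← Finset.mul_sum, sum_biasedBin, mul_one, hc]
  have h : ∀ x ∈ Finset.range (m + 1),
      (biasedBin m v x + ∑ i ∈ s, c i * biasedBin m (u i) x) ^ 2 / biasedBin m 0 x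
        ≤ 2 * biasedBin m v x + 2 * (∑ i ∈ s, c i * biasedBin m (u i) x) - biasedBin m 0 x
          + 2 * ((biasedBin m v x - biasedBin m 0 x) ^ 2 / biasedBin m 0 x)
          + 2 * ((∑ i ∈ s, c i * biasedBin m (u i) x) ^ 2 / biasedBin m 0 x) := by
    intro x hx
    have hb := biasedBin_zero_pos (Nat.lt_succ_iff.mp (Finset.mem_range.mp hx))
    generalize ∑ i ∈ s, c i * biasedBin m (u i) x = g
    generalize biasedBin m v x = a
    generalize biasedBin m 0 x = b at hb
    rw [div_le_iff₀ hb]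
    have : (2 * a + 2 * g - b + 2 * ((a - b) ^ 2 / b) + 2 * (g ^ 2 / b)) * b
        = (2 * a + 2 * g - b) * b + 2 * (a - b) ^ 2 + 2 * g ^ 2 := by
      field_simp
    rw [this]
    -- (a+g)² = b² + 2b(a+g-b) + ((a-b)+g)², and the last square is at most 2(a-b)² + 2g².
    nlinarith [sq_nonneg (a - b - g)]
  refine (Finset.sum_le_sum h).trans ?_
  rw [Finset.sum_add_distrib, Finset.sum_add_distrib, Finset.sum_sub_distrib,
    Finset.sum_add_distrib, ← Finset.mul_sum, ← Finset.mul_sum, ← Finset.mul_sum,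
    ← Finset.mul_sum, sum_biasedBin, sum_biasedBin, sum_sq_sub_div, hsum]
  have := sum_sq_mixture_div_le (c := c) hE
  linarith

theorem one_add_mul_self_pow_le (m : ℕ) (u : ℝ) : (1 + u * u) ^ m ≤ Real.exp (m * u ^ 2) := by
  rw [Real.exp_nat_mul]
  refine pow_le_pow_left₀ (by nlinarith [sq_nonneg u]) ?_ m
  nlinarith [Real.add_one_le_exp (u ^ 2)]

theorem pow_sub_one_le {m : ℕ} {v δ : ℝ} (hδ : δ ^ 2 ≤ 1 / 4) (hmv : m * v ^ 2 = 4 * δ ^ 2) :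
    (1 + v * v) ^ m - 1 ≤ 8 * δ ^ 2 := by
  have h1 := one_add_mul_self_pow_le m v
  rw [hmv] at h1
  have h2 := Real.abs_exp_sub_one_le (x := 4 * δ ^ 2)
    (by rw [abs_of_nonneg (by positivity)]; linarith)
  rw [abs_of_nonneg (a := 4 * δ ^ 2) (by positivity)] at h2
  linarith [(abs_le.mp h2).2]

/-- By Cauchy–Schwarz against the fair binomial, the squared ℓ¹ distance is at most the χ² sum,
which is at most 8δ² ≤ (3δ)². -/
theorem sum_abs_biasedBin_sub_le {m : ℕ} {v δ : ℝ} (hδ0 : 0 ≤ δ) (hδ : δ ^ 2 ≤ 1 / 4)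
    (hmv : m * v ^ 2 = 4 * δ ^ 2) :
    ∑ x ∈ Finset.range (m + 1), |biasedBin m 0 x - biasedBin m v x| ≤ 3 * δ := by
  have h1 := Finset.sq_sum_div_le_sum_sq_div (Finset.range (m + 1))
    (fun x ↦ |biasedBin m 0 x - biasedBin m v x|) (g := biasedBin m 0)
    (fun x hx ↦ biasedBin_zero_pos (Nat.lt_succ_iff.mp (Finset.mem_range.mp hx)))
  rw [sum_biasedBin, div_one] at h1
  have h2 : ∑ x ∈ Finset.range (m + 1), |biasedBin m 0 x - biasedBin m v x| ^ 2 / biasedBin m 0 x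
      = (1 + v * v) ^ m - 1 := by
    rw [← sum_sq_sub_div]
    exact Finset.sum_congr rfl fun x _ ↦ by rw [sq_abs, sub_sq_comm]
  rw [h2] at h1
  refine abs_le_of_sq_le_sq' (?_ : _ ≤ (3 * δ) ^ 2) (by positivity) |>.2
  nlinarith [pow_sub_one_le hδ hmv, sq_nonneg δ]

/-! ### The fair binomial as a candidate for A -/

theorem half_add_mem_Icc {δ : ℝ} {m : ℕ} (hδ0 : 0 ≤ δ) (hδ : δ ≤ 1 / 2) (hm : (1 : ℝ) ≤ m) :
    1 / 2 + δ / √(m : ℝ) ∈ Set.Icc (0 : ℝ) 1 := by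
  have hs : 1 ≤ √(m : ℝ) := Real.one_le_sqrt.mpr hm
  have h1 : 0 ≤ δ / √(m : ℝ) := by positivity
  have h2 : δ / √(m : ℝ) ≤ δ := div_le_self hδ0 hs
  constructor <;> linarith

/-- The fair binomial distribution is within `3 δ` in total variation of the biased one. -/
theorem tvDist_half_le {δ : ℝ} {m : ℕ} (hδ0 : 0 ≤ δ) (hδ : δ ≤ 1 / 2) (hm : (1 : ℝ) ≤ m)
    (hp : 1 / 2 + δ / √(m : ℝ) ∈ Set.Icc (0 : ℝ) 1) :
    tvDist (binDist m (1 / 2) half_mem_Icc) (binDist m (1 / 2 + δ / √(m : ℝ)) hp) ≤ 3 * δ := by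
  have hs : 1 ≤ √(m : ℝ) := Real.one_le_sqrt.mpr hm
  have hs2 : √(m : ℝ) ^ 2 = m := Real.sq_sqrt (by linarith)
  have hv : |2 * δ / √(m : ℝ)| ≤ 1 := by
    rw [abs_of_nonneg (by positivity), div_le_one (by positivity)]
    linarith
  rw [← massMeasure_biasedBin (u := 0) half_mem_Icc (by norm_num),
    ← massMeasure_biasedBin (u := 2 * δ / √(m : ℝ)) hp (by ring)]
  refine (tvDist_massMeasure_le (fun x hx ↦ (biasedBin_zero_pos hx).le)
    fun x _ ↦ biasedBin_nonneg hv).trans ?_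
  refine sum_abs_biasedBin_sub_le hδ0 (by nlinarith) ?_
  rw [div_pow, hs2]
  field_simp
  ring

theorem chiSqDiv_half_self (m : ℕ) : chiSqDiv (binDist m (1 / 2) half_mem_Icc)
    (binDist m (1 / 2) half_mem_Icc) = 0 := by
  rw [← massMeasure_biasedBin (u := 0) half_mem_Icc (by norm_num),
    chiSqDiv_massMeasure (fun x hx ↦ (biasedBin_zero_pos hx).le)
      fun x hx ↦ biasedBin_zero_pos hx]
  have h : ∀ x ∈ Finset.range (m + 1), biasedBin m 0 x ^ 2 / biasedBin m 0 x = biasedBin m 0 x := by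
    intro x hx
    have := biasedBin_zero_pos (Nat.lt_succ_iff.mp (Finset.mem_range.mp hx))
    field_simp
  rw [Finset.sum_congr rfl h, sum_biasedBin]
  simp

theorem binDist_lt {m : ℕ} {p : ℝ} (hp : p ∈ Set.Icc (0 : ℝ) 1) :
    binDist m p hp {x : ℕ | m < x} = 0 := by
  rw [← massMeasure_biasedBin (u := 2 * p - 1) hp (by ring)]
  exact massMeasure_lt _ _

/-! ### Nonnegativity and choice of parameters -/

/-- Nonnegativity of the mixture with weights `mixWeight`: near the centre the first summand
dominates, and in the two tails the extreme nodes do. -/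
theorem biasedBin_add_mixture_nonneg {n m : ℕ} {v₀ α Z B : ℝ} (hn : Odd n) (hv : 0 < v₀)
    (hα : 2 * v₀ ≤ α) (hB : v₀ + n * α ≤ B) (hB2 : B ≤ 1 / 2) (hZ : m * B ≤ Z / 2)
    (hvZ : 2 * v₀ * (Z + m * (2 * v₀)) ≤ 3 / 8)
    (hcen : 4 * ((n : ℝ) + 1) ^ 2 * (v₀ / (n * α)) * Real.exp (Z * B) ≤ 1 / 2)
    (htail : 4 * ((n : ℝ) + 1) ^ 2 * (2 * (n : ℝ) ^ 2) ^ n ≤ Real.exp (α / 2 * Z / 2))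
    {x : ℕ} (hx : x ≤ m) :
    0 ≤ biasedBin m (2 * v₀) x
      + ∑ i ∈ mixIndex n, mixWeight n v₀ α i * biasedBin m (v₀ + mixNode v₀ α i) x := by
  have hα0 : 0 < α := by linarith
  have hn1 : 1 ≤ n := hn.pos
  have hnR : (1 : ℝ) ≤ n := by exact_mod_cast hn1
  have hαn : α ≤ n * α := by nlinarith
  have hB0 : 0 < B := by linarith
  have hZ0 : 0 ≤ Z := by nlinarith [mul_nonneg (Nat.cast_nonneg (α := ℝ) m) hB0.le]
  set y := m - x with hy
  have hxy : (x : ℝ) + y = m := by exact_mod_cast (by omega : x + y = m)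
  have hxy' : (y : ℝ) + x = m := by linarith
  have huB : ∀ i ∈ mixIndex n, |v₀ + mixNode v₀ α i| ≤ B := fun i hi ↦ by
    have := abs_mixNode_le hv (by linarith) hα0.le hi
    exact (abs_add_le _ _).trans (by rw [abs_of_pos hv]; linarith)
  have hu : ∀ i ∈ mixIndex n, |v₀ + mixNode v₀ α i| ≤ 1 := fun i hi ↦ (huB i hi).trans (by linarith)
  have hW := sum_abs_mixWeight_le hv (by linarith : v₀ ≤ α) hn1
  have hlast : ∀ b, ∑ i ∈ mixIndex n, |mixWeight n v₀ α i|
      ≤ mixWeight n v₀ α (b, n) * Real.exp (α / 2 * Z / 2) := by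
    intro b
    refine hW.trans ?_
    have h1 := le_mixWeight_last hv hα hn b
    have h2 : 0 ≤ v₀ / (n * α) := by positivity
    have h3 : 4 * ((n : ℝ) + 1) ^ 2 * (v₀ / (n * α))
        = (1 / (2 * (n : ℝ) ^ 2)) ^ n * (v₀ / (n * α)) *
          (4 * ((n : ℝ) + 1) ^ 2 * (2 * (n : ℝ) ^ 2) ^ n) := by
      rw [div_pow, one_pow]
      have : (2 * (n : ℝ) ^ 2) ^ n ≠ 0 := by positivity
      field_simp
    rw [h3]
    exact mul_le_mul h1 htail (by positivity) ((by positivity : (0 : ℝ) ≤ _).trans h1)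
  have hmem : ∀ b, (b, n) ∈ mixIndex n := fun b ↦ by
    simp only [mixIndex, Finset.mem_product, Finset.mem_univ, Finset.mem_insert, Finset.mem_Icc]
    exact ⟨trivial, Or.inr ⟨hn1, le_rfl⟩⟩
  have hnode : ∀ b, mixNode v₀ α (b, n) = boolSign b * (n * α) := fun b ↦ by
    simp [mixNode, show n ≠ 0 by omega]
  have hRv : 0 ≤ (1 + 2 * v₀) ^ x * (1 - 2 * v₀) ^ y :=
    mul_nonneg (pow_nonneg (by linarith) _) (pow_nonneg (by linarith) _)
  have key : 0 ≤ (1 + 2 * v₀) ^ x * (1 - 2 * v₀) ^ y + ∑ i ∈ mixIndex n, mixWeight n v₀ α i *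
      ((1 + (v₀ + mixNode v₀ α i)) ^ x * (1 - (v₀ + mixNode v₀ α i)) ^ y) := by
    rcases le_or_gt |(x : ℝ) - y| Z with hc | hc
    · refine tilt_add_sum_nonneg (by linarith) (by linarith) hc (by rwa [hxy]) hu huB ?_
      exact (mul_le_mul_of_nonneg_right hW (Real.exp_pos _).le).trans hcen
    -- In the tails the main term is merely nonnegative; the correction must be nonnegative by
    -- itself.
    · refine add_nonneg hRv ?_
      rcases lt_abs.mp hc with hc | hc
      · have hU : v₀ + mixNode v₀ α (true, n) = v₀ + n * α := by simp [hnode, boolSign]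
        refine sum_tilt_nonneg_of_dominant (u := fun i ↦ v₀ + mixNode v₀ α i) (hmem true)
          (D := α / 2) hu ?_ ?_ (by linarith) (fun i hi hne ↦ ?_) hc.le hZ0 ?_ (hlast true)
        · simp only [hU]; positivity
        · simp only [hU]; linarith
        · have := mixNode_gap hv hα hn1 hi true hne
          simp only [boolSign, if_true, one_mul] at this
          simp only [hU]; linarith
        · simp only [hU, hxy]
          exact (mul_le_mul_of_nonneg_left hB (Nat.cast_nonneg m)).trans hZ
      · have hU : -(v₀ + mixNode v₀ α (false, n)) = n * α - v₀ := by
          simp only [hnode, boolSign, Bool.false_eq_true, if_false]; ring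
        -- The left tail is the right tail after exchanging x with y and negating every bias.
        have h := sum_tilt_nonneg_of_dominant (x := y) (y := x) (Z := Z)
          (u := fun i ↦ -(v₀ + mixNode v₀ α i)) (hmem false)
          (D := α / 2) (fun i hi ↦ by simpa only [abs_neg] using hu i hi) ?_ ?_ (by linarith)
          (fun i hi hne ↦ ?_) (by linarith) hZ0 ?_ (hlast false)
        · refine h.trans_eq (Finset.sum_congr rfl fun i _ ↦ ?_)
          simp only [sub_neg_eq_add, ← sub_eq_add_neg]
          ring
        · simp only [hU]; linarith
        · simp only [hU]; linarith
        · have := mixNode_gap hv hα hn1 hi false hne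
          simp only [boolSign, Bool.false_eq_true, if_false] at this
          simp only [hU]; linarith
        · simp only [hU, hxy']
          exact (mul_le_mul_of_nonneg_left (by linarith) (Nat.cast_nonneg m)).trans hZ
  have hfac : biasedBin m (2 * v₀) x
      + ∑ i ∈ mixIndex n, mixWeight n v₀ α i * biasedBin m (v₀ + mixNode v₀ α i) x
      = biasedBin m 0 x * ((1 + 2 * v₀) ^ x * (1 - 2 * v₀) ^ y + ∑ i ∈ mixIndex n,
        mixWeight n v₀ α i *
          ((1 + (v₀ + mixNode v₀ α i)) ^ x * (1 - (v₀ + mixNode v₀ α i)) ^ y)) := by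
    rw [mul_add, Finset.mul_sum, biasedBin_eq_mul_zero]
    congr 1
    refine Finset.sum_congr rfl fun i _ ↦ ?_
    rw [biasedBin_eq_mul_zero]
    ring
  rw [hfac]
  exact mul_nonneg (biasedBin_zero_pos hx).le key

theorem exists_measure_of_pow_four_lt {δ L p : ℝ} {k m : ℕ} (hδ0 : 0 < δ)
    (hL : Real.log (1 / δ) = L) (hΛ : (768 : ℝ) ^ 4 ≤ L) (hk1 : 1 ≤ k) (hk : (k : ℝ) ^ 4 < L)
    (hm : L ≤ m) (hpv : p = 1 / 2 + δ / √(m : ℝ)) (hp : p ∈ Set.Icc (0 : ℝ) 1) :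
    ∃ A : Measure ℕ, IsProbabilityMeasure A ∧ A {x : ℕ | m < x} = 0 ∧
      (∀ i : ℕ, 1 ≤ i → i ≤ k →
        ∫ x : ℕ, (x : ℝ) ^ i ∂A = ∫ x : ℕ, (x : ℝ) ^ i ∂(binDist m (1 / 2) half_mem_Icc)) ∧
      tvDist A (binDist m p hp) ≤ 108 * (δ * (k : ℝ) ^ 2 / √L) ∧
      chiSqDiv A (binDist m (1 / 2) half_mem_Icc) ≤ ENNReal.ofReal (24000 * δ) := by
  obtain ⟨n, hn, hkn, hnk⟩ : ∃ n, Odd n ∧ k ≤ n ∧ n ≤ k + 1 := by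
    rcases Nat.even_or_odd k with h | h
    · exact ⟨k + 1, h.add_one, by omega, le_rfl⟩
    · exact ⟨k, h, le_rfl, by omega⟩
  have hn1 : 1 ≤ n := hn.pos
  have hnR : (1 : ℝ) ≤ n := by exact_mod_cast hn1
  have hkR : (1 : ℝ) ≤ k := by exact_mod_cast hk1
  have hnkR : (n : ℝ) ≤ k + 1 := by exact_mod_cast hnk
  -- E = δ^(-1/2) is the largest amplification of the correction that has to be absorbed by its mass
  -- O(δ).
  set E := Real.exp (L / 2) with hE
  have hEL : L / 2 + 1 ≤ E := hE ▸ Real.add_one_le_exp _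
  have hL0 : 0 < L := by linarith [hΛ, (by norm_num : (0 : ℝ) < 768 ^ 4)]
  have hE0 : 0 < E := Real.exp_pos _
  have hδE : δ * E ^ 2 = 1 := by
    have : E ^ 2 = 1 / δ := by
      rw [hE, ← Real.exp_nat_mul, show ((2 : ℕ) : ℝ) * (L / 2) = L by push_cast; ring, ← hL,
        Real.exp_log (by positivity)]
    rw [this]; field_simp
  clear_value E
  have hEbig : (100000 : ℝ) ≤ E := by
    refine le_trans ?_ hEL
    linarith [hΛ, (by norm_num : (200000 : ℝ) < 768 ^ 4)]
  have hδE1 : δ * E ≤ 1 / 100000 := by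
    rw [le_div_iff₀ (by norm_num)]
    calc δ * E * 100000 ≤ δ * E * E := by gcongr
      _ = 1 := by rw [← hδE]; ring
  have hδs : δ ≤ 1 / 100000 := by nlinarith only [hδE1, hδ0, hEbig]
  set r := √L with hr
  have hr2 : r ^ 2 = L := Real.sq_sqrt hL0.le
  have hr0 : 0 < r := Real.sqrt_pos.mpr hL0
  have hkr : (k : ℝ) ^ 2 ≤ r := by
    refine Real.le_sqrt_of_sq_le ?_
    nlinarith
  have hk2 : (k : ℝ) ≤ k ^ 2 := by nlinarith
  have hr1 : 1 ≤ r := by linarith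
  have hrL : r ≤ L := by nlinarith
  have hδr : δ * r ≤ 1 / 50000 := by
    have : δ * r ≤ δ * (2 * E) := mul_le_mul_of_nonneg_left (by linarith) hδ0.le
    linarith
  set s := √(m : ℝ) with hs
  have hm0 : (0 : ℝ) < m := by linarith
  have hs2 : s ^ 2 = m := Real.sq_sqrt hm0.le
  have hs0 : 0 < s := Real.sqrt_pos.mpr hm0
  have hrs : r ≤ s := Real.sqrt_le_sqrt hm
  clear_value r s
  have hn3 : 96 * (n : ℝ) ^ 3 ≤ L := by
    have h1 : (n : ℝ) ^ 3 ≤ (2 * k) ^ 3 := pow_le_pow_left₀ (by linarith) (by linarith) 3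
    -- The threshold 768⁴ ≤ L covers k ≤ 768; for larger k, 768k³ ≤ k⁴ < L. Here 768 = 96 · 8, the 8
    -- coming from n ≤ 2k.
    have h2 : 768 * (k : ℝ) ^ 3 ≤ L := by
      rcases le_or_gt (k : ℝ) 768 with h | h
      · calc 768 * (k : ℝ) ^ 3 ≤ 768 * 768 ^ 3 := by gcongr
          _ ≤ L := by linarith
      · calc 768 * (k : ℝ) ^ 3 ≤ k * (k : ℝ) ^ 3 := by gcongr
          _ = (k : ℝ) ^ 4 := by ring
          _ ≤ L := hk.le
    have h3 : (2 * (k : ℝ)) ^ 3 = 8 * (k : ℝ) ^ 3 := by ring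
    linarith
  clear hΛ hk
  set v₀ := δ / s with hv₀
  -- Then nα = √L/(3√m), so that the extreme biases v₀ ± nα stay within B = √L/(2√m). With Z = √(Lm)
  -- this gives mB = Z/2 and ZB = L/2.
  set α := r / (3 * n * s) with hα
  have hv0 : 0 < v₀ := by positivity
  have hα0 : 0 < α := by positivity
  clear_value α v₀
  have hnα : n * α = r / (3 * s) := by rw [hα]; field_simp
  have hτ : v₀ / (n * α) = 3 * δ / r := by rw [hnα, hv₀]; field_simp
  have hnr : (n : ℝ) ≤ 2 * r := by linarith
  have h2v : 2 * v₀ ≤ α := by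
    rw [hv₀, hα, ← mul_div_assoc, div_le_div_iff₀ hs0 (by positivity)]
    have h1 : δ * n ≤ δ * (2 * r) := by gcongr
    calc 2 * δ * (3 * n * s) = (6 * (δ * n)) * s := by ring
      _ ≤ r * s := mul_le_mul_of_nonneg_right (by linarith) hs0.le
  set B := r / (2 * s) with hBdef
  clear_value B
  have hB : v₀ + n * α ≤ B := by
    rw [hnα, hv₀, hBdef]
    have : δ / s + r / (3 * s) = (δ + r / 3) / s := by field_simp
    rw [this, ← div_div]
    gcongr
    linarith
  have hB2 : B ≤ 1 / 2 := by
    rw [hBdef, div_le_div_iff₀ (by positivity) (by norm_num)]; linarith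
  have hmB : m * B = r * s / 2 := by rw [hBdef, ← hs2]; field_simp
  have hZB : r * s * B = L / 2 := by rw [hBdef, ← hr2]; field_simp
  have hn2 : ((n : ℝ) + 1) ^ 2 ≤ 9 * k ^ 2 := by nlinarith only [hnkR, hkR, hnR]
  -- 108 = 4 · 9 · 3, from (n+1)² ≤ 9k² and v₀/(nα) = 3δ/√L.
  have hWle : 4 * ((n : ℝ) + 1) ^ 2 * (v₀ / (n * α)) ≤ 108 * (δ * (k : ℝ) ^ 2 / r) := by
    rw [hτ]
    calc 4 * ((n : ℝ) + 1) ^ 2 * (3 * δ / r) ≤ 4 * (9 * k ^ 2) * (3 * δ / r) := by gcongr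
      _ = _ := by ring
  have hWδ : 4 * ((n : ℝ) + 1) ^ 2 * (v₀ / (n * α)) ≤ 108 * δ := by
    refine hWle.trans ?_
    have : δ * (k : ℝ) ^ 2 / r ≤ δ := by
      rw [div_le_iff₀ hr0]; gcongr
    linarith
  have hW := sum_abs_mixWeight_le hv0 (by linarith : v₀ ≤ α) hn1
  have hmom : ∀ q ≤ k, (2 * v₀) ^ q + ∑ i ∈ mixIndex n,
      mixWeight n v₀ α i * (v₀ + mixNode v₀ α i) ^ q = 0 ^ q := fun q hq ↦
    sum_mul_shift_pow (fun q hq ↦ sum_mixWeight_mul_pow hα0.ne' (hq.trans hkn) hn1) hq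
  have huB : ∀ i ∈ mixIndex n, |v₀ + mixNode v₀ α i| ≤ B := fun i hi ↦ by
    have := abs_mixNode_le hv0 (by linarith [le_mul_of_one_le_left hα0.le hnR]) hα0.le hi
    exact (abs_add_le _ _).trans (by rw [abs_of_pos hv0]; linarith)
  have hmv : m * (2 * v₀) ^ 2 = 4 * δ ^ 2 := by
    rw [hv₀, ← hs2]; field_simp; ring
  have hcore : 2 * v₀ * (r * s + m * (2 * v₀)) ≤ 3 / 8 := by
    have h1 : 2 * v₀ * (r * s + m * (2 * v₀)) = 2 * (δ * r) + 4 * δ ^ 2 := by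
      rw [hv₀, ← hs2]; field_simp; ring
    rw [h1]; nlinarith only [hδ0, hδs, hδr]
  have hcen : 4 * ((n : ℝ) + 1) ^ 2 * (v₀ / (n * α)) * Real.exp (r * s * B) ≤ 1 / 2 := by
    rw [hZB, ← hE]
    calc _ ≤ 108 * δ * E := by gcongr
      _ ≤ 1 / 2 := by linarith
  have htail : 4 * ((n : ℝ) + 1) ^ 2 * (2 * (n : ℝ) ^ 2) ^ n
      ≤ Real.exp (α / 2 * (r * s) / 2) := by
    have h1 : α / 2 * (r * s) / 2 = L / (12 * n) := by rw [hα, ← hr2]; field_simp; norm_num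
    rw [h1]
    exact mul_pow_le_exp hn1 hn3
  obtain ⟨A, hA1, hA2, hA3, hA4, hA5⟩ := exists_measure_of_mixture (mixIndex n)
    (mixWeight n v₀ α) (fun i ↦ v₀ + mixNode v₀ α i) (m := m) (k := k) (v := 2 * v₀) hp
    (by rw [hpv]; ring) (fun i hi ↦ (huB i hi).trans (by linarith))
    (fun x hx ↦ biasedBin_add_mixture_nonneg (Z := r * s) (B := B) hn hv0 h2v hB hB2
      hmB.le hcore hcen htail hx) hmom
  refine ⟨A, hA1, hA2, hA3, hA4.trans (hW.trans hWle), ?_⟩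
  rw [hA5, tsub_le_iff_right, ← ENNReal.ofReal_one,
    ← ENNReal.ofReal_add (by positivity) one_pos.le]
  refine ENNReal.ofReal_le_ofReal ?_
  have hc0 : ∑ i ∈ mixIndex n, mixWeight n v₀ α i = 0 := by
    have := hmom 0 (Nat.zero_le _)
    simp only [pow_zero, mul_one] at this
    linarith
  refine (sum_sq_add_mixture_div_le (E := E) hc0 fun i hi ↦ ?_).trans ?_
  -- (1 + u²)^m ≤ exp(mB²) = exp(L/4), well below E.
  · rw [hE]
    refine (one_add_mul_self_pow_le _ _).trans (Real.exp_le_exp.mpr ?_)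
    have h1 : (v₀ + mixNode v₀ α i) ^ 2 ≤ B ^ 2 := sq_le_sq' (abs_le.mp (huB i hi)).1
      (abs_le.mp (huB i hi)).2
    have h2 : m * B ^ 2 = L / 4 := by rw [hBdef, ← hs2, ← hr2]; field_simp; norm_num
    have h3 := mul_le_mul_of_nonneg_left h1 hm0.le
    linarith
  · have h1 := pow_sub_one_le (δ := δ) (by nlinarith only [hδ0, hδs]) hmv
    have h2 : (∑ i ∈ mixIndex n, |mixWeight n v₀ α i|) ^ 2 * E ≤ (108 * δ) ^ 2 * E := by
      gcongr
      exact hW.trans hWδ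
    have h3 : (108 * δ) ^ 2 * E ≤ 11664 * δ := by
      have : (108 * δ) ^ 2 * E = 11664 * δ * (δ * E) := by ring
      rw [this]
      nlinarith only [hδ0, hδE1]
    nlinarith only [h1, h2, h3, hδ0, hδs]

theorem proposition4p4 :
    ∃ (δ₀ : ℝ) (k₀ : ℕ) (C₀ K : ℝ), 0 < δ₀ ∧ 0 < C₀ ∧ 0 < K ∧
      ∀ (δ : ℝ), 0 < δ → δ ≤ δ₀ →
      ∀ (k : ℕ), k₀ ≤ k →
      ∀ (m : ℕ), max (C₀ * Real.log (1 / δ) ^ 3) ((k : ℝ) ^ 2 / Real.log (1 / δ)) ≤ (m : ℝ) →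
        ∃ hp : 1 / 2 + δ / √(m : ℝ) ∈ Set.Icc (0 : ℝ) 1,
        ∃ A : Measure ℕ, IsProbabilityMeasure A ∧ A {x : ℕ | m < x} = 0 ∧
          (∀ i : ℕ, 1 ≤ i → i ≤ k →
            ∫ x : ℕ, (x : ℝ) ^ i ∂A = ∫ x : ℕ, (x : ℝ) ^ i ∂(binDist m (1 / 2) half_mem_Icc)) ∧
          tvDist A (binDist m (1 / 2 + δ / √(m : ℝ)) hp)
            ≤ K * (δ * (k : ℝ) ^ 2 / √(Real.log (1 / δ))) ∧
          chiSqDiv A (binDist m (1 / 2) half_mem_Icc) ≤ ENNReal.ofReal (K * δ) := by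
  -- This δ₀ means log(1/δ) ≥ 768⁴. The constant 24000 exceeds 2 · 108² = 23328 plus the small χ²
  -- term 16δ² of the main component, as well as the total variation constants 108 and 3.
  refine ⟨Real.exp (-768 ^ 4), 1, 1, 24000, Real.exp_pos _, one_pos, by norm_num, ?_⟩
  intro δ hδ0 hδ k hk m hm
  have hL : (768 : ℝ) ^ 4 ≤ Real.log (1 / δ) := by
    rw [one_div, Real.log_inv, le_neg, ← Real.log_exp (-768 ^ 4)]
    exact Real.log_le_log hδ0 hδ
  have hδ2 : δ ≤ 1 / 2 := by
    have h1 : Real.exp (-768 ^ 4) ≤ Real.exp (-Real.log 2) := by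
      refine Real.exp_le_exp.mpr (neg_le_neg ?_)
      linarith [Real.log_two_lt_d9, (by norm_num : (1 : ℝ) ≤ 768 ^ 4)]
    rw [Real.exp_neg (Real.log 2), Real.exp_log two_pos] at h1
    exact (hδ.trans h1).trans (by norm_num)
  have h1L : 1 ≤ Real.log (1 / δ) := le_trans (by norm_num) hL
  generalize hLdef : Real.log (1 / δ) = L at *
  have hmL : L ≤ m := by
    refine le_trans ?_ ((le_max_left _ _).trans hm)
    rw [one_mul]
    exact le_self_pow₀ h1L (by norm_num)
  have hp := half_add_mem_Icc hδ0.le hδ2 (h1L.trans hmL)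
  refine ⟨hp, ?_⟩
  -- If k⁴ ≥ L, the allowed total variation is at least Kδ, and the fair binomial is already within
  -- 3δ of the target.
  rcases lt_or_ge ((k : ℝ) ^ 4) L with h | h
  · obtain ⟨A, h1, h2, h3, h4, h5⟩ := exists_measure_of_pow_four_lt hδ0 hLdef hL hk h hmL rfl hp
    refine ⟨A, h1, h2, h3, h4.trans ?_, h5⟩
    gcongr
    norm_num
  · refine ⟨binDist m (1 / 2) half_mem_Icc, inferInstance, binDist_lt _, fun _ _ _ ↦ rfl, ?_, ?_⟩
    · refine (tvDist_half_le hδ0.le hδ2 (h1L.trans hmL) hp).trans ?_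
      have hr0 : 0 < √L := Real.sqrt_pos.mpr (by linarith)
      have hr : √L ≤ (k : ℝ) ^ 2 := Real.sqrt_le_iff.mpr ⟨by positivity, by linarith [h]⟩
      have : δ ≤ δ * (k : ℝ) ^ 2 / √L := by
        rw [le_div_iff₀ hr0]; gcongr
      linarith
    · rw [chiSqDiv_half_self]; exact zero_le
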